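/- Let $\mathcal G$ be the group of finite sets of nonnegative integers under symmetric difference (so that $\emptyset$ is the neutral element), and let $\mathbf C[\mathcal G]$ be its group algebra with the trace $\psi(\sum_A x_A A)=x_\emptyset$. For integers $r,n\ge 1$ and $t\in[0,+\infty)$ put $$L_r(n,t)=\frac1{n^{r/2}}\sum_{(a_1,\dots,a_r)}\{a_1,\dots,a_r\}\in\mathbf C[\mathcal G],$$ where the sum runs over all $r$-tuples of pairwise distinct integers of $[1,nt]$. Let $(H_r)_{r\ge 0}$ be the Hermite polynomials, given by $H_0(x)=1$, $H_1(x)=x$ and $xH_r(x)=H_{r+1}(x)+rH_{r-1}(x)$ for $r\ge1$. Theorem. There are a probability space $(\Omega,\mathbf P)$ and a family $(L_r(t))_{r\ge1,\,t\in[0,+\infty)}$ of real random variables on it, having moments of all orders, such that 1. $(L_1(t))_{t\in[0,+\infty)}$ is a classical (standard, real) Brownian motion; 2. $L_r(t)=t^{r/2}H_r\bigl(t^{-1/2}L_1(t)\bigr)$ for all $r\ge1$ and $t>0$, and $L_r(0)=0$ for all $r\ge1$; 3. as $n\to\infty$, the distribution of the family $(L_r(n,t))_{r\ge1,\,t\in[0,+\infty)}$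 in $(\mathbf C[\mathcal G],\psi)$ converges to that of $(L_r(t))_{r\ge1,\,t\in[0,+\infty)}$, that is, for every polynomial $Q$ with complex coefficients in non commutative variables $(X_{r,t})_{r\ge1,\,t\in[0,+\infty)}$, $$\lim_{n\to\infty}\psi\bigl(Q((L_r(n,t))_{r,t})\bigr)=\mathbf E\bigl[Q((L_r(t))_{r,t})\bigr].$$ -/

import Mathlib

open MeasureTheory ProbabilityTheory Filter Topology
open scoped NNReal

/-- The set of finite sets of nonnegative integers, which carries below the (multiplicatively
written) group law given by the symmetric difference. -/
def FinsetGroup : Type := Finset ℕ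

/-- A finite set of nonnegative integers, seen as a group element. -/
def FinsetGroup.mk (A : Finset ℕ) : FinsetGroup := A

/-- The group of finite sets of nonnegative integers: the product is the symmetric difference,
the neutral element is the empty set and every element is its own inverse. -/
instance FinsetGroup.instCommGroup : CommGroup FinsetGroup where
  mul A B := FinsetGroup.mk (symmDiff (α := Finset ℕ) A B)
  mul_assoc A B C := symmDiff_assoc (α := Finset ℕ) A B C
  one := FinsetGroup.mk ∅
  one_mul A := bot_symmDiff (α := Finset ℕ) A
  mul_one A := symmDiff_bot (α := Finset ℕ) A
  inv A := A
  inv_mul_cancel A := symmDiff_self (α := Finset ℕ) A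
  mul_comm A B := symmDiff_comm (α := Finset ℕ) A B

theorem FinsetGroup.mk_mul (A B : Finset ℕ) :
    FinsetGroup.mk A * FinsetGroup.mk B = FinsetGroup.mk (symmDiff A B) := rfl

theorem FinsetGroup.mk_empty : FinsetGroup.mk ∅ = 1 := rfl

/-- The canonical trace on the group algebra `ℂ[G]`: the coefficient of the neutral element. -/
def canonicalTrace (G : Type*) [Group G] : MonoidAlgebra ℂ G →ₗ[ℂ] ℂ where
  toFun x := x.coeff 1
  map_add' x y := by simp
  map_smul' c x := by simp

/-- The (non commutative) distribution of a family `x` of elements of a complex unital algebra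
endowed with a linear form `φ`: it maps a polynomial `p` in the non commutative variables
`(X i)` to `φ (p (x))`. -/
noncomputable def ncDistribution {ι A : Type*} [Ring A] [Algebra ℂ A] (φ : A →ₗ[ℂ] ℂ)
    (x : ι → A) (p : FreeAlgebra ℂ ι) : ℂ :=
  φ (FreeAlgebra.lift ℂ x p)

/-- The random variable `p (X)`, for a family `X` of real random variables and a polynomial `p`
with complex coefficients in (non commutative) variables. -/
noncomputable def polyRandomVariable {ι Ω : Type*} (X : ι → Ω → ℝ) (p : FreeAlgebra ℂ ι)
    (ω : Ω) : ℂ :=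
  FreeAlgebra.lift ℂ (fun i => (X i ω : ℂ)) p

/-- The distribution of a commutative family of real random variables: it maps a polynomial `p`
to the expectation of `p (X)`. -/
noncomputable def classicalDistribution {ι Ω : Type*} [MeasurableSpace Ω] (P : Measure Ω)
    (X : ι → Ω → ℝ) (p : FreeAlgebra ℂ ι) : ℂ :=
  ∫ ω, polyRandomVariable X p ω ∂P

/-- The `r`-tuples `(a₁, …, a_r)` of pairwise distinct integers of `[1, n t]`. -/
noncomputable def distinctTuples (r n : ℕ) (t : ℝ≥0) : Finset (Fin r → ℕ) :=
  {a ∈ Fintype.piFinset fun _ : Fin r => Finset.Icc 1 ⌊(n : ℝ) * (t : ℝ)⌋₊ |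
    Function.Injective a}

theorem mem_distinctTuples {r n : ℕ} {t : ℝ≥0} {a : Fin r → ℕ} :
    a ∈ distinctTuples r n t ↔
      (∀ i, 1 ≤ a i ∧ (a i : ℝ) ≤ (n : ℝ) * (t : ℝ)) ∧ Function.Injective a := by
  have h : (0 : ℝ) ≤ (n : ℝ) * (t : ℝ) := by positivity
  simp [distinctTuples, Nat.le_floor_iff h]

/-- The element `L_r(n, t) = n ^ (-r/2) ∑ {a₁, …, a_r}` of the group algebra, the sum running over
the `r`-tuples of pairwise distinct integers of `[1, n t]`. -/
noncomputable def setSum (r n : ℕ) (t : ℝ≥0) : MonoidAlgebra ℂ FinsetGroup :=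
  (((n : ℝ) ^ (-(r : ℝ) / 2) : ℝ) : ℂ) •
    ∑ a ∈ distinctTuples r n t,
      MonoidAlgebra.of ℂ FinsetGroup (FinsetGroup.mk (Finset.univ.image a))

/-- The quantity `t ^ (r/2) H_r (t ^ (-1/2) x)`, where `H_r` is the `r`-th (probabilists') Hermite
polynomial. For `t = 0` and `r ≥ 1` it equals `0`. -/
noncomputable def scaledHermite (r : ℕ) (t : ℝ≥0) (x : ℝ) : ℝ :=
  (t : ℝ) ^ ((r : ℝ) / 2) *
    Polynomial.aeval ((t : ℝ) ^ (-(1 / 2) : ℝ) * x) (Polynomial.hermite r)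

theorem scaledHermite_zero {r : ℕ} (hr : 1 ≤ r) (x : ℝ) : scaledHermite r 0 x = 0 := by
  have h : (r : ℝ) / 2 ≠ 0 := by positivity
  simp [scaledHermite, Real.zero_rpow h]

/-! The elements `x_a = n ^ (-1/2) • {a}` commute, satisfy `x_a ^ 2 = 1 / n`, and the product of `r`
of them with distinct indices is `n ^ (-r/2) • {a₁, …, a_r}`. So `L_r(n, t)` is a discrete multiple
Wiener integral, and `wickSum` is its version with a different time for each index.

Everything comes from one product formula (`wickSum_singleton_mul`). In `L_1(n, s)` times a
`wickSum`, the new index either avoids all the others, giving a longer `wickSum`, or equals one of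
them, giving a contraction. A contraction with time `t` costs `1 / n` and leaves about `n * min s t`
free indices, so it has weight `min s t` up to `O(1 / n)`. As the trace kills every nonempty
`wickSum`, the joint moments of the `L_1(n, t)` tend to sums over pairings with covariance `min s
t`. By Wick's formula (`integral_prod_eq_contraction`) these are the moments of Brownian motion.

With all times equal, the same formula becomes, up to `O(1 / n)`, the three-term recurrence of the
rescaled Hermite polynomials (`setSum_add_two`, `scaledHermite_add_two`). Hence `L_r` is
asymptotically a polynomial in `L_1`. Testing convergence against all products of `L_1`'s gives a
notion, `JointLimit`, stable under multiplication by each `L_r(n, t)`, and so under all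
noncommutative polynomials.

Brownian motion itself is built by Lévy's method, from independent Gaussians and the Schauder
functions. -/

/-! ### Sums over the choice of an element of a list -/

section PickSum

/-- The sum of `f a l'` over all the ways of choosing an element `a` of the list `l`, where `l'` is
the list of the remaining elements. -/
def pickSum {α M : Type*} [AddCommMonoid M] : (α → List α → M) → List α → M
  | _, [] => 0
  | f, a :: l => f a l + pickSum (fun b l' => f b (a :: l')) l

variable {α β M N : Type*}

@[simp]
theorem pickSum_nil [AddCommMonoid M] (f : α → List α → M) : pickSum f [] = 0 := rfl

theorem pickSum_cons [AddCommMonoid M] (f : α → List α → M) (a : α) (l : List α) :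
    pickSum f (a :: l) = f a l + pickSum (fun b l' => f b (a :: l')) l := rfl

/-- The length restriction lets a strong induction hypothesis on the length of the list be applied
under `pickSum`. -/
theorem pickSum_congr [AddCommMonoid M] {f g : α → List α → M} {l : List α}
    (h : ∀ a l', l'.length < l.length → f a l' = g a l') : pickSum f l = pickSum g l := by
  induction l generalizing f g with
  | nil => rfl
  | cons a l ih =>
    rw [pickSum_cons, pickSum_cons, h a l (by simp)]
    congr 1
    exact ih fun b l' hl => h b _ (by simpa using hl)

theorem pickSum_zero [AddCommMonoid M] (l : List α) :
    pickSum (fun _ _ => (0 : M)) l = 0 := by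
  induction l with
  | nil => rfl
  | cons a l ih => rw [pickSum_cons, ih, add_zero]

theorem pickSum_add [AddCommMonoid M] (f g : α → List α → M) (l : List α) :
    pickSum (fun a l' => f a l' + g a l') l = pickSum f l + pickSum g l := by
  induction l generalizing f g with
  | nil => simp
  | cons a l ih => rw [pickSum_cons, pickSum_cons, pickSum_cons, ih]; abel

theorem map_pickSum [AddCommMonoid M] [AddCommMonoid N] (φ : M →+ N) (f : α → List α → M)
    (l : List α) : φ (pickSum f l) = pickSum (fun a l' => φ (f a l')) l := by
  induction l generalizing f with
  | nil => simp
  | cons a l ih => rw [pickSum_cons, pickSum_cons, map_add, ih]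

theorem pickSum_mul_left [NonUnitalNonAssocSemiring M] (c : M) (f : α → List α → M) (l : List α) :
    pickSum (fun a l' => c * f a l') l = c * pickSum f l :=
  (map_pickSum (AddMonoidHom.mulLeft c) f l).symm

theorem pickSum_finsetSum [AddCommMonoid M] (s : Finset β) (f : β → α → List α → M)
    (l : List α) :
    ∑ b ∈ s, pickSum (f b) l = pickSum (fun a l' => ∑ b ∈ s, f b a l') l := by
  induction l generalizing f with
  | nil => simp
  | cons a l ih => simp only [pickSum_cons, Finset.sum_add_distrib, ih]

/-- Choosing successively two elements of a list, the order does not matter. -/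
theorem pickSum_pickSum_swap [AddCommMonoid M] (F : α → α → List α → M) (l : List α) :
    pickSum (fun a l' => pickSum (fun b l'' => F a b l'') l') l =
      pickSum (fun a l' => pickSum (fun b l'' => F b a l'') l') l := by
  induction l generalizing F with
  | nil => rfl
  | cons c l ih =>
    simp only [pickSum_cons, pickSum_add]
    rw [ih]
    abel

theorem pickSum_comm [AddCommMonoid M] (F : α → List α → β → List β → M) (l : List α)
    (m : List β) :
    pickSum (fun a l' => pickSum (fun b m' => F a l' b m') m) l =
      pickSum (fun b m' => pickSum (fun a l' => F a l' b m') l) m := by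
  induction l generalizing F with
  | nil => simp [pickSum_zero]
  | cons c l ih => simp only [pickSum_cons, pickSum_add, ih]

theorem pickSum_replicate [AddCommMonoid M] (f : α → List α → M) (a : α) (r : ℕ) :
    pickSum f (List.replicate r a) = r • f a (List.replicate (r - 1) a) := by
  induction r generalizing f with
  | zero => simp
  | succ r ih =>
    rw [List.replicate_succ, pickSum_cons, ih]
    cases r with
    | zero => simp
    | succ r =>
      rw [Nat.add_sub_cancel, Nat.add_sub_cancel, ← List.replicate_succ, succ_nsmul' _ (r + 1)]

theorem tendsto_pickSum [AddCommMonoid M] [TopologicalSpace M] [ContinuousAdd M] {ι : Type*}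
    {u : Filter ι} {f : ι → α → List α → M} {g : α → List α → M} {l : List α}
    (h : ∀ a l', Tendsto (fun i => f i a l') u (𝓝 (g a l'))) :
    Tendsto (fun i => pickSum (f i) l) u (𝓝 (pickSum g l)) := by
  induction l generalizing f g with
  | nil => exact tendsto_const_nhds
  | cons a l ih => exact (h a l).add (ih fun b l' => h b _)

end PickSum

/-! ### The contraction numbers -/

section Contraction

variable {α : Type*} (κ : α → α → ℝ)

/-- The sum over all the pairings of the elements of `l` and `m`, without pairs of elements of `m`,
of the product of the values of `κ` on the pairs. -/
noncomputable def contraction : List α → List α → ℝ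
  | [], m => if m = [] then 1 else 0
  | a :: l, m => contraction l (a :: m) + pickSum (fun b m' => κ a b * contraction l m') m

/-- Elements of the second list are never paired together, so `a` must find its partner in `l`.
Since `contraction κ (s :: l) []` is `contraction κ l [s]`, this is the recursion of Wick's formula.
-/
theorem contraction_cons_right (l m : List α) (a : α) (hκ : ∀ a b, κ a b = κ b a) :
    contraction κ l (a :: m) = pickSum (fun b l' => κ a b * contraction κ l' m) l := by
  induction h : l.length using Nat.strong_induction_on generalizing l m a with
  | _ k ih =>
    cases l with
    | nil => simp [contraction]
    | cons b l =>
      simp only [List.length_cons] at h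
      -- The two heads choose their partners in `l` one after the other, and the order of the
      -- choices is irrelevant.
      have h1 : contraction κ l (b :: a :: m) = contraction κ l (a :: b :: m) := by
        rw [ih _ (by lia) l (a :: m) b rfl, ih _ (by lia) l (b :: m) a rfl]
        have key : ∀ x y : α, pickSum (fun c l' => κ x c * contraction κ l' (y :: m)) l =
            pickSum (fun c l' => pickSum (fun d l'' => κ x c * (κ y d * contraction κ l'' m)) l')
              l := by
          intro x y
          refine pickSum_congr fun c l' hl => ?_
          rw [ih _ (by lia) l' m y rfl, pickSum_mul_left]
        rw [key, key, pickSum_pickSum_swap]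
        refine pickSum_congr fun c l' _ => pickSum_congr fun d l'' _ => ?_
        ring
      rw [contraction, h1, ih _ (by lia) l (b :: m) a rfl]
      simp only [pickSum_cons, contraction, mul_add, pickSum_add]
      rw [hκ b a]
      have h2 : pickSum (fun b_1 m' => κ b b_1 * contraction κ l (a :: m')) m =
          pickSum (fun b_1 l' => κ a b_1 * pickSum (fun c m' => κ b c * contraction κ l' m') m)
            l := by
        simp only [← pickSum_mul_left]
        rw [pickSum_comm]
        refine pickSum_congr fun c l' _ => ?_
        rw [ih _ (by lia) l l' a rfl, ← pickSum_mul_left]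
        refine pickSum_congr fun d l'' _ => ?_
        ring
      rw [h2]
      abel

end Contraction

/-! ### Sums over the tuples of distinct elements -/

section DistinctSum

variable {A ι : Type*} [CommRing A] (y : ℕ → A) (I : ι → Finset ℕ)

/-- The sum of the products `y a₁ * ⋯ * y a_r` over the tuples of pairwise distinct integers which
are outside of `F` and such that `a_i` belongs to `I t_i`, where `l` is the list of the `t_i`. -/
def distinctSum : Finset ℕ → List ι → A
  | _, [] => 1
  | F, t :: l => ∑ a ∈ I t \ F, y a * distinctSum (insert a F) l

/-- The entries being distinct, `a` occurs in a tuple either nowhere or at exactly one position;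
`pickSum` runs over that position. -/
theorem distinctSum_eq_insert_add {a : ℕ} {F : Finset ℕ} (ha : a ∉ F) (l : List ι) :
    distinctSum y I F l = distinctSum y I (insert a F) l +
      pickSum (fun t l' => if a ∈ I t then y a * distinctSum y I (insert a F) l' else 0) l := by
  induction l generalizing F with
  | nil => simp [distinctSum]
  | cons t l ih =>
    have h1 : ∀ b ∈ I t \ insert a F, y b * distinctSum y I (insert b F) l =
        y b * distinctSum y I (insert b (insert a F)) l + pickSum (fun t' l' =>
          if a ∈ I t' then y a * (y b * distinctSum y I (insert b (insert a F)) l') else 0) l := by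
      intro b hb
      simp only [Finset.mem_sdiff, Finset.mem_insert, not_or] at hb
      rw [ih (F := insert b F) (by simp [ha, Ne.symm hb.2.1]), mul_add, ← pickSum_mul_left,
        Finset.insert_comm]
      congr 1
      refine pickSum_congr fun t' l' _ => ?_
      split_ifs
      · ring
      · simp
    have h2 : ∑ b ∈ I t \ F, y b * distinctSum y I (insert b F) l =
        (if a ∈ I t then y a * distinctSum y I (insert a F) l else 0) +
          ∑ b ∈ I t \ insert a F, y b * distinctSum y I (insert b F) l := by
      rw [Finset.sdiff_insert]
      split_ifs with hat
      · exact (Finset.add_sum_erase _ (fun b => y b * distinctSum y I (insert b F) l)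
          (by simp [hat, ha])).symm
      · rw [Finset.erase_eq_of_notMem (by simp [hat]), zero_add]
    rw [distinctSum, h2, Finset.sum_congr rfl h1, Finset.sum_add_distrib, pickSum_finsetSum,
      pickSum_cons, distinctSum]
    have h3 : (fun (t' : ι) (l' : List ι) => ∑ b ∈ I t \ insert a F,
        if a ∈ I t' then y a * (y b * distinctSum y I (insert b (insert a F)) l') else 0) =
        fun t' l' => if a ∈ I t' then y a * distinctSum y I (insert a F) (t :: l') else 0 := by
      funext t' l'
      split_ifs
      · rw [distinctSum, Finset.mul_sum]
      · simp
    rw [h3]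
    abel

theorem sum_mul_distinctSum_empty [Min ι] (hI : ∀ s t, I (min s t) = I s ∩ I t) {c : A}
    (hy : ∀ a, y a * y a = c) (s : ι) (l : List ι) :
    (∑ a ∈ I s, y a) * distinctSum y I ∅ l = distinctSum y I ∅ (s :: l) +
      pickSum (fun t l' => c * ((I (min s t)).card * distinctSum y I ∅ l' -
        pickSum (fun t' l'' => distinctSum y I ∅ (min (min s t) t' :: l'')) l')) l := by
  -- The index freed by a contraction must still avoid the remaining ones. Dropping this constraint
  -- gives the cardinality; the excess, where `a` equals an index of time `t'`, is again a sum over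
  -- distinct tuples because `I t ∩ I t' = I (min t t')`.
  have h1 : ∀ (t : ι) (l' : List ι), ∑ a ∈ I t, distinctSum y I {a} l' =
      (I t).card * distinctSum y I ∅ l' -
        pickSum (fun t' l'' => distinctSum y I ∅ (min t t' :: l'')) l' := by
    intro t l'
    have : ∀ a ∈ I t, distinctSum y I {a} l' = distinctSum y I ∅ l' -
        pickSum (fun t' l'' => if a ∈ I t' then y a * distinctSum y I {a} l'' else 0) l' := by
      intro a _
      rw [eq_sub_iff_add_eq]
      exact (distinctSum_eq_insert_add y I (Finset.notMem_empty a) l').symm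
    rw [Finset.sum_congr rfl this, Finset.sum_sub_distrib, Finset.sum_const, nsmul_eq_mul,
      pickSum_finsetSum]
    congr 1
    refine pickSum_congr fun t' l'' _ => ?_
    rw [distinctSum, Finset.sdiff_empty, hI, ← Finset.filter_mem_eq_inter, Finset.sum_filter]
    rfl
  have h2 : ∀ a ∈ I s, y a * distinctSum y I ∅ l = y a * distinctSum y I {a} l +
      pickSum (fun t l' => if a ∈ I t then c * distinctSum y I {a} l' else 0) l := by
    intro a _
    rw [distinctSum_eq_insert_add y I (Finset.notMem_empty a) l, mul_add, ← pickSum_mul_left]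
    congr 1
    refine pickSum_congr fun t l' _ => ?_
    split_ifs
    · rw [← mul_assoc, hy]; rfl
    · simp
  rw [Finset.sum_mul, Finset.sum_congr rfl h2, Finset.sum_add_distrib, pickSum_finsetSum]
  congr 1
  · rw [distinctSum, Finset.sdiff_empty]; rfl
  · refine pickSum_congr fun t l' _ => ?_
    rw [← h1, hI, ← Finset.filter_mem_eq_inter, Finset.mul_sum, Finset.sum_filter]

end DistinctSum

/-! ### Moments in the group algebra of the group of finite sets -/

section SetSum

/-- The integers of `[1, n t]`. -/
noncomputable def timeRange (n : ℕ) (t : ℝ≥0) : Finset ℕ := Finset.Icc 1 ⌊(n : ℝ) * (t : ℝ)⌋₊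

theorem timeRange_min (n : ℕ) (s t : ℝ≥0) :
    timeRange n (min s t) = timeRange n s ∩ timeRange n t := by
  have h : ⌊(n : ℝ) * ((min s t : ℝ≥0) : ℝ)⌋₊ =
      min ⌊(n : ℝ) * (s : ℝ)⌋₊ ⌊(n : ℝ) * (t : ℝ)⌋₊ := by
    rw [NNReal.coe_min, mul_min_of_nonneg _ _ (Nat.cast_nonneg n)]
    exact Nat.floor_mono.map_min
  ext a
  simp only [timeRange, h, Finset.mem_inter, Finset.mem_Icc, le_min_iff]
  tauto

theorem tendsto_card_timeRange_div (t : ℝ≥0) :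
    Tendsto (fun n : ℕ => (n : ℂ)⁻¹ * ((timeRange n t).card : ℂ)) atTop (𝓝 ((t : ℝ) : ℂ)) := by
  have h := (tendsto_nat_floor_mul_div_atTop (R := ℝ) t.coe_nonneg).comp
    tendsto_natCast_atTop_atTop
  refine ((Complex.continuous_ofReal.tendsto _).comp h).congr fun n => ?_
  simp [timeRange, mul_comm, div_eq_mul_inv]

/-- The group element `{a}`, multiplied by `n ^ (-1/2)`. -/
noncomputable def scaledSingleton (n a : ℕ) : MonoidAlgebra ℂ FinsetGroup :=
  (((n : ℝ) ^ (-(1 : ℝ) / 2) : ℝ) : ℂ) • MonoidAlgebra.of ℂ FinsetGroup (FinsetGroup.mk {a})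

theorem scaledSingleton_mul_self {n : ℕ} (hn : n ≠ 0) (a : ℕ) :
    scaledSingleton n a * scaledSingleton n a = algebraMap ℂ _ (n : ℂ)⁻¹ := by
  have hn' : (0 : ℝ) < n := by positivity
  rw [scaledSingleton, smul_mul_smul_comm, ← map_mul, FinsetGroup.mk_mul, symmDiff_self,
    Finset.bot_eq_empty, FinsetGroup.mk_empty, map_one, Algebra.algebraMap_eq_smul_one,
    ← Complex.ofReal_mul, ← Real.rpow_add hn']
  norm_num [Real.rpow_neg_one]

/-- The sum of the products of the `scaledSingleton n a_i`, over the tuples of pairwise distinct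
integers such that `a_i` belongs to `[1, n t_i]`, where `l` is the list of the `t_i`. -/
noncomputable def wickSum (n : ℕ) (l : List ℝ≥0) : MonoidAlgebra ℂ FinsetGroup :=
  distinctSum (scaledSingleton n) (timeRange n) ∅ l

/-- `G` collects the indices already multiplied out. Later indices avoid `F`, hence `G`, so
symmetric differences are disjoint unions and nothing cancels back to `∅`. -/
theorem canonicalTrace_of_mul_distinctSum (n : ℕ) {F G : Finset ℕ} (hG : G ⊆ F)
    (l : List ℝ≥0) :
    canonicalTrace FinsetGroup (MonoidAlgebra.of ℂ FinsetGroup (FinsetGroup.mk G) *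
      distinctSum (scaledSingleton n) (timeRange n) F l) = if G = ∅ ∧ l = [] then 1 else 0 := by
  induction l generalizing F G with
  | nil =>
    have h : FinsetGroup.mk G = 1 ↔ G = ∅ := Iff.rfl
    rw [distinctSum, mul_one]
    change (MonoidAlgebra.single (FinsetGroup.mk G) (1 : ℂ)).coeff 1 = _
    classical
    rw [MonoidAlgebra.coeff_single, Finsupp.single_apply]
    simp [h]
  | cons t l ih =>
    rw [distinctSum, Finset.mul_sum, map_sum, if_neg (by simp)]
    refine Finset.sum_eq_zero fun a ha => ?_
    have haF : a ∉ F := (Finset.mem_sdiff.1 ha).2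
    have haG : Disjoint G {a} := by
      rw [Finset.disjoint_singleton_right]
      exact fun h => haF (hG h)
    rw [scaledSingleton, ← mul_assoc, mul_smul_comm, ← map_mul, FinsetGroup.mk_mul,
      haG.symmDiff_eq_sup, smul_mul_assoc, map_smul, ih, if_neg, smul_zero]
    · simp [Finset.sup_eq_union]
    · rw [Finset.sup_eq_union, Finset.union_comm, ← Finset.insert_eq]
      exact Finset.insert_subset_insert a hG

theorem canonicalTrace_wickSum (n : ℕ) (l : List ℝ≥0) :
    canonicalTrace FinsetGroup (wickSum n l) = if l = [] then 1 else 0 := by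
  have h := canonicalTrace_of_mul_distinctSum n (Finset.empty_subset ∅) l
  rw [FinsetGroup.mk_empty, map_one, one_mul] at h
  simpa [wickSum] using h

theorem wickSum_singleton (n : ℕ) (t : ℝ≥0) :
    wickSum n [t] = ∑ a ∈ timeRange n t, scaledSingleton n a := by
  simp [wickSum, distinctSum]

theorem wickSum_singleton_mul {n : ℕ} (hn : n ≠ 0) (s : ℝ≥0) (l : List ℝ≥0) :
    wickSum n [s] * wickSum n l = wickSum n (s :: l) + pickSum (fun t l' =>
      algebraMap ℂ _ (n : ℂ)⁻¹ * ((timeRange n (min s t)).card * wickSum n l' -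
        pickSum (fun t' l'' => wickSum n (min (min s t) t' :: l'')) l')) l := by
  rw [wickSum_singleton]
  exact sum_mul_distinctSum_empty _ _ (timeRange_min n) (scaledSingleton_mul_self hn) s l

theorem canonicalTrace_algebraMap_mul (c : ℂ) (x : MonoidAlgebra ℂ FinsetGroup) :
    canonicalTrace FinsetGroup (algebraMap ℂ _ c * x) = c * canonicalTrace FinsetGroup x := by
  rw [← Algebra.smul_def, map_smul, smul_eq_mul]

/-- Multiplication by `z`, followed by the trace. -/
noncomputable def traceMul (z : MonoidAlgebra ℂ FinsetGroup) :
    MonoidAlgebra ℂ FinsetGroup →ₗ[ℂ] ℂ :=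
  canonicalTrace FinsetGroup ∘ₗ LinearMap.mulLeft ℂ z

theorem traceMul_apply (z x : MonoidAlgebra ℂ FinsetGroup) :
    traceMul z x = canonicalTrace FinsetGroup (z * x) := rfl

theorem traceMul_pickSum {α : Type*} (z : MonoidAlgebra ℂ FinsetGroup)
    (f : α → List α → MonoidAlgebra ℂ FinsetGroup) (l : List α) :
    traceMul z (pickSum f l) = pickSum (fun a l' => traceMul z (f a l')) l :=
  map_pickSum (traceMul z).toAddMonoidHom f l

theorem traceMul_algebraMap_mul (z x : MonoidAlgebra ℂ FinsetGroup) (c : ℂ) :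
    traceMul z (algebraMap ℂ _ c * x) = c * traceMul z x := by
  rw [← Algebra.smul_def, map_smul, smul_eq_mul]

theorem traceMul_natCast_mul (z x : MonoidAlgebra ℂ FinsetGroup) (k : ℕ) :
    traceMul z (k * x) = k * traceMul z x := by
  rw [← map_natCast (algebraMap ℂ (MonoidAlgebra ℂ FinsetGroup)), traceMul_algebraMap_mul]

/-- The covariance of Brownian motion. -/
noncomputable def minCov (s t : ℝ≥0) : ℝ := (min s t : ℝ≥0)

theorem tendsto_traceMul_wickSum (l m : List ℝ≥0) :
    Tendsto (fun n : ℕ => traceMul (l.map fun s => wickSum n [s]).prod (wickSum n m)) atTop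
      (𝓝 ((contraction minCov l m : ℝ) : ℂ)) := by
  induction l generalizing m with
  | nil =>
    refine tendsto_const_nhds.congr fun n => ?_
    simp only [traceMul_apply, List.map_nil, List.prod_nil, one_mul, canonicalTrace_wickSum,
      contraction]
    split_ifs <;> simp
  | cons s l ih =>
    have hinv : Tendsto (fun n : ℕ => (n : ℂ)⁻¹) atTop (𝓝 0) := tendsto_inv_atTop_nhds_zero_nat
    -- The subtracted sum carries a factor `n⁻¹` with no cardinality to compensate it; this is the
    -- origin of the `0 *` in the limit.
    have h : Tendsto (fun n : ℕ => traceMul (l.map fun s => wickSum n [s]).prod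
        (wickSum n (s :: m)) + pickSum (fun t m' =>
          (n : ℂ)⁻¹ * ((timeRange n (min s t)).card : ℂ) *
            traceMul (l.map fun s => wickSum n [s]).prod (wickSum n m') -
          (n : ℂ)⁻¹ * pickSum (fun t' m'' => traceMul (l.map fun s => wickSum n [s]).prod
            (wickSum n (min (min s t) t' :: m''))) m') m) atTop
        (𝓝 ((contraction minCov l (s :: m) : ℝ) + pickSum (fun t m' =>
          ((min s t : ℝ≥0) : ℝ) * ((contraction minCov l m' : ℝ) : ℂ) -
          0 * pickSum (fun t' m'' =>
            ((contraction minCov l (min (min s t) t' :: m'') : ℝ) : ℂ)) m') m)) := by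
      refine (ih _).add (tendsto_pickSum fun t m' => ?_)
      exact ((tendsto_card_timeRange_div _).mul (ih _)).sub
        (hinv.mul (tendsto_pickSum fun t' m'' => ih _))
    have hlim : (((contraction minCov (s :: l) m : ℝ)) : ℂ) =
        (contraction minCov l (s :: m) : ℝ) + pickSum (fun t m' =>
          ((min s t : ℝ≥0) : ℝ) * ((contraction minCov l m' : ℝ) : ℂ) -
          0 * pickSum (fun t' m'' =>
            ((contraction minCov l (min (min s t) t' :: m'') : ℝ) : ℂ)) m') m := by
      rw [contraction, Complex.ofReal_add]
      congr 1
      have := map_pickSum Complex.ofRealHom.toAddMonoidHom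
        (fun b m' => minCov s b * contraction minCov l m') m
      simpa [minCov] using this
    rw [hlim]
    refine h.congr' ?_
    filter_upwards [eventually_ne_atTop 0] with n hn
    -- Commutativity moves the factor of time `s` next to `wickSum n m`, where the product formula
    -- applies; hence `m` is arbitrary in the induction.
    have hz : ∀ z : MonoidAlgebra ℂ FinsetGroup, traceMul (wickSum n [s] * z) (wickSum n m) =
        traceMul z (wickSum n [s] * wickSum n m) := fun z => by
      rw [traceMul_apply, traceMul_apply, mul_comm (wickSum n [s]), mul_assoc]
    rw [List.map_cons, List.prod_cons, hz, wickSum_singleton_mul hn, map_add, traceMul_pickSum]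
    congr 1
    refine pickSum_congr fun t m' _ => ?_
    rw [traceMul_algebraMap_mul, map_sub, traceMul_natCast_mul, traceMul_pickSum]
    ring

theorem image_cons_eq_insert {r : ℕ} (b : ℕ) (a : Fin r → ℕ) :
    Finset.univ.image (Fin.cons b a : Fin (r + 1) → ℕ) = insert b (Finset.univ.image a) := by
  ext c
  simp [Fin.exists_fin_succ, eq_comm]

theorem distinctSum_replicate (n r : ℕ) (t : ℝ≥0) (F : Finset ℕ) :
    distinctSum (scaledSingleton n) (timeRange n) F (List.replicate r t) =
      ((((n : ℝ) ^ (-(1 : ℝ) / 2)) ^ r : ℝ) : ℂ) •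
        ∑ a ∈ {a ∈ Fintype.piFinset fun _ : Fin r => timeRange n t \ F | Function.Injective a},
          MonoidAlgebra.of ℂ FinsetGroup (FinsetGroup.mk (Finset.univ.image a)) := by
  induction r generalizing F with
  | zero =>
    simp [distinctSum, Function.injective_of_subsingleton, FinsetGroup.mk_empty,
      MonoidAlgebra.one_def]
  | succ r ih =>
    rw [List.replicate_succ, distinctSum]
    simp only [ih, scaledSingleton, smul_mul_smul_comm, Finset.mul_sum, ← Complex.ofReal_mul,
      ← pow_succ', ← Finset.smul_sum]
    congr 1
    rw [Finset.sum_sigma']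
    refine Finset.sum_bij' (fun x _ => Fin.cons x.1 x.2) (fun a _ => ⟨a 0, Fin.tail a⟩)
      ?_ ?_ ?_ ?_ ?_
    · rintro ⟨b, a⟩ h
      simp only [Finset.mem_sigma, Finset.mem_filter, Fintype.mem_piFinset, Finset.mem_sdiff,
        Finset.mem_insert, not_or] at h
      simp only [Finset.mem_filter, Fintype.mem_piFinset, Finset.mem_sdiff, Fin.forall_fin_succ,
        Fin.cons_zero, Fin.cons_succ, Fin.cons_injective_iff, Set.mem_range, not_exists]
      exact ⟨⟨h.1, fun i => ⟨(h.2.1 i).1, (h.2.1 i).2.2⟩⟩, fun i => (h.2.1 i).2.1, h.2.2⟩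
    · intro a h
      simp only [Finset.mem_filter, Fintype.mem_piFinset, Finset.mem_sdiff] at h
      simp only [Finset.mem_sigma, Finset.mem_filter, Fintype.mem_piFinset, Finset.mem_sdiff,
        Finset.mem_insert, not_or]
      refine ⟨h.1 0, fun i => ⟨(h.1 i.succ).1, fun hi => ?_, (h.1 i.succ).2⟩,
        h.2.comp (Fin.succ_injective r)⟩
      exact Fin.succ_ne_zero i (h.2 hi)
    · rintro ⟨b, a⟩ _
      simp
    · intro a _
      simp
    · rintro ⟨b, a⟩ h
      simp only [Finset.mem_sigma, Finset.mem_filter, Fintype.mem_piFinset, Finset.mem_sdiff,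
        Finset.mem_insert, not_or] at h
      have hd : Disjoint ({b} : Finset ℕ) (Finset.univ.image a) := by
        simpa using fun i => (h.2.1 i).2.1
      rw [← map_mul, FinsetGroup.mk_mul, hd.symmDiff_eq_sup, image_cons_eq_insert]
      rfl

theorem setSum_eq_wickSum {r : ℕ} (n : ℕ) (t : ℝ≥0) :
    setSum r n t = wickSum n (List.replicate r t) := by
  rw [wickSum, distinctSum_replicate, setSum, ← Real.rpow_mul_natCast (Nat.cast_nonneg n)]
  simp only [Finset.sdiff_empty]
  rw [show -(1 : ℝ) / 2 * (r : ℝ) = -(r : ℝ) / 2 by ring]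
  rfl

theorem setSum_one (n : ℕ) (t : ℝ≥0) : setSum 1 n t = wickSum n [t] :=
  setSum_eq_wickSum n t

/-- This is the product formula with equal times: there are `r + 1` indices to contract with, and
the freed index must avoid the `r` others, whence `card - r`. -/
theorem setSum_add_two {n : ℕ} (hn : n ≠ 0) (r : ℕ) (t : ℝ≥0) :
    setSum (r + 2) n t = setSum 1 n t * setSum (r + 1) n t -
      algebraMap ℂ _ ((r + 1) * ((n : ℂ)⁻¹ * (timeRange n t).card - (n : ℂ)⁻¹ * r)) *
        setSum r n t := by
  have h := wickSum_singleton_mul hn t (List.replicate (r + 1) t)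
  rw [setSum_one, setSum_eq_wickSum, setSum_eq_wickSum, setSum_eq_wickSum, h,
    ← List.replicate_succ, pickSum_replicate]
  simp only [min_self, pickSum_replicate, Nat.add_sub_cancel, map_mul, map_sub, map_add,
    map_one, map_natCast, nsmul_eq_mul, Nat.cast_add, Nat.cast_one]
  -- For `r = 0` the list `replicate (r - 1) t` is truncated, but its coefficient vanishes.
  cases r with
  | zero => simp; ring
  | succ r =>
    rw [Nat.add_sub_cancel, ← List.replicate_succ]
    ring

end SetSum

/-! ### Moments of Brownian motion -/

section GaussianMoments

variable {Ω : Type*} [MeasurableSpace Ω] {P : Measure Ω}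

/-- The property of having moments of all orders. -/
def HasAllMoments {E : Type*} [NormedAddCommGroup E] (Z : Ω → E) (P : Measure Ω) : Prop :=
  ∀ p : ℝ≥0, MemLp Z p P

namespace HasAllMoments

variable {𝕜 : Type*} [RCLike 𝕜]

theorem integrable {Z : Ω → 𝕜} (h : HasAllMoments Z P) : Integrable Z P :=
  memLp_one_iff_integrable.1 (by simpa using h 1)

theorem add {Z W : Ω → 𝕜} (hZ : HasAllMoments Z P) (hW : HasAllMoments W P) :
    HasAllMoments (fun ω => Z ω + W ω) P := fun p => (hZ p).add (hW p)

theorem mul {Z W : Ω → 𝕜} (hZ : HasAllMoments Z P) (hW : HasAllMoments W P) :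
    HasAllMoments (fun ω => Z ω * W ω) P := by
  intro p
  have h := fun q : ℝ≥0 => hZ q
  -- Hölder's inequality: two factors in `L^(2p)` have their product in `L^p`.
  have : ENNReal.HolderTriple ((2 * p : ℝ≥0) : ENNReal) ((2 * p : ℝ≥0) : ENNReal) (p : ENNReal) := by
    constructor
    rw [ENNReal.coe_mul, ENNReal.mul_inv (by simp) (by simp), ← add_mul]
    simp [ENNReal.inv_two_add_inv_two]
  exact (hW (2 * p)).mul' (hZ (2 * p))

theorem const [IsFiniteMeasure P] (c : 𝕜) : HasAllMoments (fun _ => c) P := fun _ => memLp_const c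

theorem const_mul {Z : Ω → 𝕜} (c : 𝕜) (hZ : HasAllMoments Z P) :
    HasAllMoments (fun ω => c * Z ω) P := fun p => (hZ p).const_mul c

theorem pow [IsFiniteMeasure P] {Z : Ω → 𝕜} (hZ : HasAllMoments Z P) (k : ℕ) :
    HasAllMoments (fun ω => Z ω ^ k) P := by
  induction k with
  | zero => simpa using const (P := P) (1 : 𝕜)
  | succ k ih => simpa only [pow_succ] using ih.mul hZ

theorem list_prod [IsFiniteMeasure P] {ι : Type*} {X : ι → Ω → 𝕜}
    (hX : ∀ i, HasAllMoments (X i) P) (l : List ι) :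
    HasAllMoments (fun ω => (l.map fun i => X i ω).prod) P := by
  induction l with
  | nil => simpa using const (P := P) (1 : 𝕜)
  | cons i l ih => simpa using (hX i).mul ih

theorem ofReal {Z : Ω → ℝ} (hZ : HasAllMoments Z P) : HasAllMoments (fun ω => (Z ω : ℂ)) P :=
  fun p => (hZ p).ofReal

end HasAllMoments

/-- The moment generating function `M` satisfies `M' = v t M`; differentiating this `k + 1` times
and evaluating at `0` gives the recursion. -/
theorem integral_id_pow_gaussianReal (v : ℝ≥0) (k : ℕ) :
    ∫ x, x ^ (k + 2) ∂gaussianReal 0 v = v * (k + 1) * ∫ x, x ^ k ∂gaussianReal 0 v := by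
  have hint : ∀ m : ℕ, ∫ x, x ^ m ∂gaussianReal 0 v =
      iteratedDeriv m (mgf id (gaussianReal 0 v)) 0 := by
    intro m
    rw [iteratedDeriv_mgf_zero]
    · rfl
    · simp [integrableExpSet_id_gaussianReal]
  have hmgf : mgf id (gaussianReal 0 v) = fun t => Real.exp (v * t ^ 2 / 2) := by
    rw [mgf_id_gaussianReal]; simp
  have hderiv : deriv (fun t : ℝ => Real.exp (v * t ^ 2 / 2)) =
      fun t => (v * t) * Real.exp (v * t ^ 2 / 2) := by
    funext t
    have h : HasDerivAt (fun t : ℝ => v * t ^ 2 / 2) (v * t) t := by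
      have := ((hasDerivAt_pow 2 t).const_mul (v : ℝ)).div_const 2
      refine this.congr_deriv ?_
      push_cast
      ring
    rw [h.exp.deriv, mul_comm]
  have hsmooth : ContDiff ℝ ⊤ (fun t : ℝ => Real.exp (v * t ^ 2 / 2)) := by fun_prop
  have hrec : ∀ k : ℕ, iteratedDeriv (k + 2) (fun t : ℝ => Real.exp (v * t ^ 2 / 2)) =
      fun t => v * t * iteratedDeriv (k + 1) (fun t : ℝ => Real.exp (v * t ^ 2 / 2)) t +
        v * (k + 1) * iteratedDeriv k (fun t : ℝ => Real.exp (v * t ^ 2 / 2)) t := by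
    have hd : ∀ m t, HasDerivAt (iteratedDeriv m (fun t : ℝ => Real.exp (v * t ^ 2 / 2)))
        (iteratedDeriv (m + 1) (fun t : ℝ => Real.exp (v * t ^ 2 / 2)) t) t := by
      intro m t
      rw [iteratedDeriv_succ]
      exact ((hsmooth.differentiable_iteratedDeriv m (by simp)) t).hasDerivAt
    intro k
    induction k with
    | zero =>
      funext t
      rw [iteratedDeriv_succ, iteratedDeriv_one, hderiv, iteratedDeriv_zero]
      have h := hd 0 t
      rw [iteratedDeriv_zero, iteratedDeriv_one, hderiv] at h
      have := (((hasDerivAt_id t).const_mul (v : ℝ)).mul h).deriv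
      simp only [id] at this
      refine Eq.trans this ?_
      simp
      ring
    | succ k ih =>
      funext t
      conv_lhs => rw [iteratedDeriv_succ, ih]
      have := ((((hasDerivAt_id t).const_mul (v : ℝ)).mul (hd (k + 1) t)).add
        ((hd k t).const_mul (v * (k + 1) : ℝ))).deriv
      refine Eq.trans this ?_
      simp
      ring
  rw [hint, hint, hmgf, hrec]
  simp

variable {B : ℝ≥0 → Ω → ℝ}

theorem ProbabilityTheory.IsPreBrownianReal.hasAllMoments (hB : IsPreBrownianReal B P) (t : ℝ≥0) :
    HasAllMoments (B t) P := fun _ =>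
  (hB.isGaussianProcess.hasGaussianLaw_eval t).memLp (by simp)

theorem ProbabilityTheory.IsPreBrownianReal.integral_pow_add_two (hB : IsPreBrownianReal B P)
    (t : ℝ≥0) (k : ℕ) : ∫ ω, B t ω ^ (k + 2) ∂P = t * (k + 1) * ∫ ω, B t ω ^ k ∂P := by
  have h : ∀ m : ℕ, ∫ ω, B t ω ^ m ∂P = ∫ x, x ^ m ∂gaussianReal 0 t := fun m =>
    (hB.hasLaw_eval t).integral_comp (f := fun x => x ^ m) (by fun_prop)
  rw [h, h, integral_id_pow_gaussianReal]

/-- The part of `B t` which is independent of `B s`. -/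
noncomputable def orthogonalPart (B : ℝ≥0 → Ω → ℝ) (s t : ℝ≥0) (ω : Ω) : ℝ :=
  B t ω - minCov s t / s * B s ω

/-- The coefficient `minCov s t / s` makes the covariance with `B s` vanish, and for jointly
Gaussian families zero covariance means independence. -/
theorem ProbabilityTheory.IsPreBrownianReal.indepFun_orthogonalPart (hB : IsPreBrownianReal B P)
    {s : ℝ≥0} (hs : s ≠ 0) :
    IndepFun (fun ω (t : ℝ≥0) => orthogonalPart B s t ω) (B s) P := by
  have mX t := hB.aemeasurable t
  have hind : IndepFun (fun ω (t : ℝ≥0) => orthogonalPart B s t ω)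
      (fun ω (_ : Unit) => B s ω) P := by
    apply IsGaussianProcess.indepFun_of_covariance_eq_zero
    · apply hB.isGaussianProcess.of_isGaussianProcess
      rintro (t | _)
      · exact ⟨{s, t},
          { toFun x := x ⟨t, by simp⟩ - minCov s t / s * x ⟨s, by simp⟩
            map_add' x y := by simp; ring
            map_smul' c x := by simp; ring }, by simp [orthogonalPart]⟩
      · exact ⟨{s},
          { toFun x := x ⟨s, by simp⟩
            map_add' x y := by simp
            map_smul' c x := by simp }, by simp⟩
    · intro t
      unfold orthogonalPart
      fun_prop
    · intro _
      exact mX s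
    · rintro t _
      have := hB.isGaussianProcess.isProbabilityMeasure
      have hmem : ∀ u, MemLp (B u) 2 P := fun u =>
        (hB.isGaussianProcess.hasGaussianLaw_eval u).memLp_two
      unfold orthogonalPart
      rw [covariance_fun_sub_left (hmem _) ((hmem _).const_mul _) (hmem _),
        covariance_const_mul_left, hB.covariance_fun_eval, hB.covariance_fun_eval, min_self,
        minCov, min_comm]
      have : (s : ℝ) ≠ 0 := by simpa using hs
      field_simp
      simp
  have hev : Measurable fun f : Unit → ℝ => f () := measurable_pi_apply ()
  exact hind.comp measurable_id hev

/-- Integration by parts for the moments of a pre-Brownian motion, with a factor depending only on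
the part of the process which is independent of `B s`. -/
theorem ProbabilityTheory.IsPreBrownianReal.integral_mul_pow_mul_prod
    (hB : IsPreBrownianReal B P) {s : ℝ≥0} (hs : s ≠ 0) (l : List ℝ≥0)
    (k : ℕ) (g : (ℝ≥0 → ℝ) → ℝ) (hg : Measurable g)
    (hgm : HasAllMoments (fun ω => g fun t => orthogonalPart B s t ω) P) :
    ∫ ω, g (fun t => orthogonalPart B s t ω) *
        (B s ω ^ (k + 1) * (l.map fun t => B t ω).prod) ∂P =
      s * k * ∫ ω, g (fun t => orthogonalPart B s t ω) *
        (B s ω ^ (k - 1) * (l.map fun t => B t ω).prod) ∂P +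
      pickSum (fun t l' => minCov s t * ∫ ω, g (fun t => orthogonalPart B s t ω) *
        (B s ω ^ k * (l'.map fun t => B t ω).prod) ∂P) l := by
  have hP := hB.isGaussianProcess.isProbabilityMeasure
  -- Each factor `B t` splits as `orthogonalPart B s t + (minCov s t / s) * B s`: the first term is
  -- absorbed in `g`, the second raises the power of `B s`. Once the list is empty, independence and
  -- the Gaussian recursion conclude.
  induction l generalizing k g with
  | nil =>
    have hindep := fun m : ℕ => ((hB.indepFun_orthogonalPart hs).comp hg
      (measurable_id.pow_const m)).integral_fun_mul_eq_mul_integral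
      hgm.integrable.aestronglyMeasurable ((hB.hasAllMoments s).pow m).integrable.aestronglyMeasurable
    simp only [Function.comp_def, id] at hindep
    simp only [List.map_nil, List.prod_nil, mul_one, pickSum_nil, add_zero, hindep]
    cases k with
    | zero => simp [hB.integral_eval]
    | succ k =>
      rw [hB.integral_pow_add_two, Nat.add_sub_cancel]
      push_cast
      ring
  | cons t l ih =>
    have hprod : ∀ l : List ℝ≥0, HasAllMoments (fun ω => (l.map fun t => B t ω).prod) P :=
      fun l => HasAllMoments.list_prod hB.hasAllMoments l
    have hZ : HasAllMoments (orthogonalPart B s t) P := by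
      have := (hB.hasAllMoments t).add ((hB.hasAllMoments s).const_mul (-(minCov s t / s)))
      have heq : orthogonalPart B s t = fun ω => B t ω + -(minCov s t / s) * B s ω := by
        funext ω
        simp [orthogonalPart, sub_eq_add_neg]
      rwa [heq]
    have hint : ∀ (m : ℕ) (l : List ℝ≥0) (h : (ℝ≥0 → ℝ) → ℝ),
        HasAllMoments (fun ω => h fun t => orthogonalPart B s t ω) P →
        Integrable (fun ω => h (fun t => orthogonalPart B s t ω) *
          (B s ω ^ m * (l.map fun t => B t ω).prod)) P := fun m l h hh =>
      (hh.mul (((hB.hasAllMoments s).pow m).mul (hprod l))).integrable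
    have hgZ : HasAllMoments (fun ω => g (fun t => orthogonalPart B s t ω) *
        orthogonalPart B s t ω) P := hgm.mul hZ
    have hsplit : ∀ (m : ℕ) (l' : List ℝ≥0), ∫ ω, g (fun t => orthogonalPart B s t ω) *
        (B s ω ^ m * ((t :: l').map fun t => B t ω).prod) ∂P =
        ∫ ω, (fun f => g f * f t) (fun t => orthogonalPart B s t ω) *
          (B s ω ^ m * (l'.map fun t => B t ω).prod) ∂P +
        minCov s t / s * ∫ ω, g (fun t => orthogonalPart B s t ω) *
          (B s ω ^ (m + 1) * (l'.map fun t => B t ω).prod) ∂P := by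
      intro m l'
      rw [← integral_const_mul, ← integral_add (hint m l' (fun f => g f * f t) hgZ)
        ((hint (m + 1) l' g hgm).const_mul _)]
      refine integral_congr_ae (Eventually.of_forall fun ω => ?_)
      simp only [List.map_cons, List.prod_cons, orthogonalPart]
      ring
    have hsR : (s : ℝ) ≠ 0 := by simpa using hs
    rw [hsplit, ih k (fun f => g f * f t) (by fun_prop) hgZ, ih (k + 1) g hg hgm,
      Nat.add_sub_cancel, pickSum_cons]
    simp only [hsplit, mul_add, pickSum_add]
    have hpick : pickSum (fun b l' => minCov s b * (minCov s t / s *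
        ∫ ω, g (fun t => orthogonalPart B s t ω) *
          (B s ω ^ (k + 1) * (l'.map fun t => B t ω).prod) ∂P)) l =
        minCov s t / s * pickSum (fun b l' => minCov s b *
        ∫ ω, g (fun t => orthogonalPart B s t ω) *
          (B s ω ^ (k + 1) * (l'.map fun t => B t ω).prod) ∂P) l := by
      rw [← pickSum_mul_left]
      exact pickSum_congr fun b l' _ => by ring
    rw [hpick]
    -- `k - 1 + 1` differs from `k` only for `k = 0`, where both sides vanish.
    have hk : (s : ℝ) * k * (minCov s t / s * ∫ ω, g (fun t => orthogonalPart B s t ω) *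
          (B s ω ^ (k - 1 + 1) * (l.map fun t => B t ω).prod) ∂P) =
        k * (minCov s t * ∫ ω, g (fun t => orthogonalPart B s t ω) *
          (B s ω ^ k * (l.map fun t => B t ω).prod) ∂P) := by
      cases k with
      | zero => simp
      | succ k => rw [Nat.add_sub_cancel]; field_simp
    rw [hk]
    push_cast
    field_simp
    ring

theorem ProbabilityTheory.IsPreBrownianReal.integral_mul_prod (hB : IsPreBrownianReal B P)
    (s : ℝ≥0) (l : List ℝ≥0) :
    ∫ ω, ((s :: l).map fun t => B t ω).prod ∂P =
      pickSum (fun t l' => minCov s t * ∫ ω, (l'.map fun t => B t ω).prod ∂P) l := by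
  have hP := hB.isGaussianProcess.isProbabilityMeasure
  -- The orthogonal decomposition divides by `s`; at `s = 0` both sides are zero.
  by_cases hs : s = 0
  · subst hs
    have h : ∫ ω, ((0 :: l).map fun t => B t ω).prod ∂P = 0 := by
      refine integral_eq_zero_of_ae ?_
      filter_upwards [hB.eval_zero_ae_eq_zero] with ω hω
      simp [hω]
    rw [h]
    simp [minCov, pickSum_zero]
  · simpa using hB.integral_mul_pow_mul_prod hs l 0 (fun _ => 1) measurable_const
      (HasAllMoments.const 1)

theorem ProbabilityTheory.IsPreBrownianReal.integral_prod_eq_contraction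
    (hB : IsPreBrownianReal B P) (l : List ℝ≥0) :
    ∫ ω, (l.map fun t => B t ω).prod ∂P = contraction minCov l [] := by
  have hP := hB.isGaussianProcess.isProbabilityMeasure
  induction h : l.length using Nat.strong_induction_on generalizing l with
  | _ k ih =>
    cases l with
    | nil => simp [contraction]
    | cons s l =>
      rw [hB.integral_mul_prod, contraction, pickSum_nil, add_zero,
        contraction_cons_right _ _ _ _ fun a b => by simp [minCov, min_comm]]
      refine pickSum_congr fun t l' hl => ?_
      rw [ih _ (by simp at h; lia) l' rfl]

end GaussianMoments

/-! ### Existence of Brownian motion -/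

/-! ### Schauder functions and the expansion of `min s t`. -/

section Schauder

/-- The primitive of the Haar function. -/
noncomputable def tent (x : ℝ) : ℝ := max 0 (min x (1 - x))

/-- The primitives of the functions of the Haar basis of the half-line: for `n = 0` they are the
ramps between two consecutive integers, and for `n ≥ 1` rescaled tents. -/
noncomputable def schauder : ℕ → ℕ → ℝ → ℝ
  | 0, k, t => max 0 (min 1 (t - k))
  | n + 1, k, t => (√2 ^ n)⁻¹ * tent (2 ^ n * t - k)

theorem tent_of_nonpos {x : ℝ} (hx : x ≤ 0) : tent x = 0 :=
  max_eq_left ((min_le_left _ _).trans hx)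

theorem tent_of_one_le {x : ℝ} (hx : 1 ≤ x) : tent x = 0 :=
  max_eq_left ((min_le_right _ _).trans (by linarith))

theorem abs_tent_le_one (x : ℝ) : |tent x| ≤ 1 := by
  rw [tent, abs_of_nonneg (le_max_left _ _)]
  refine max_le zero_le_one ?_
  rcases le_total x 1 with h | h
  · exact (min_le_left _ _).trans h
  · exact (min_le_right _ _).trans (by linarith)

theorem continuous_schauder (n k : ℕ) : Continuous (schauder n k) := by
  cases n with
  | zero => unfold schauder; fun_prop
  | succ n => unfold schauder tent; fun_prop

theorem schauder_eq_zero {n k : ℕ} {t : ℝ} (ht : 0 ≤ t) (h : 2 ^ n * t ≤ k) :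
    schauder n k t = 0 := by
  cases n with
  | zero =>
    refine max_eq_left ((min_le_right _ _).trans ?_)
    simpa using h
  | succ n =>
    have : (2 : ℝ) ^ n * t ≤ 2 ^ (n + 1) * t := by
      gcongr
      · norm_num
      · exact n.le_succ
    rw [schauder, tent_of_nonpos (by linarith), mul_zero]

/-- The covariance of the Brownian bridges between consecutive integers. -/
noncomputable def bridgeCov (x y : ℝ) : ℝ :=
  if ⌊x⌋₊ = ⌊y⌋₊ then min x y - ⌊x⌋₊ - (x - ⌊x⌋₊) * (y - ⌊x⌋₊) else 0

theorem abs_bridgeCov_le_one {x y : ℝ} (hx : 0 ≤ x) (hy : 0 ≤ y) : |bridgeCov x y| ≤ 1 := by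
  unfold bridgeCov
  split_ifs with h
  · have h1 := Nat.floor_le hx
    have h2 := Nat.lt_floor_add_one x
    have h3 := Nat.floor_le hy
    have h4 := Nat.lt_floor_add_one y
    rw [← h] at h3 h4
    rw [abs_le]
    rcases le_total x y with hxy | hxy
    · rw [min_eq_left hxy]
      constructor <;> nlinarith
    · rw [min_eq_right hxy]
      constructor <;> nlinarith
  · simp

theorem tent_sub_natCast_eq_zero {x : ℝ} (hx : 0 ≤ x) {k : ℕ} (hk : k ≠ ⌊x⌋₊) :
    tent (x - k) = 0 := by
  rcases hk.lt_or_gt with h | h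
  · refine tent_of_one_le ?_
    have h1 := Nat.floor_le hx
    have h2 : (k : ℝ) + 1 ≤ ⌊x⌋₊ := by exact_mod_cast h
    linarith
  · exact tent_of_nonpos (by linarith [(Nat.floor_lt hx).1 h])

theorem sum_tent_mul_tent {x y : ℝ} (hx : 0 ≤ x) (hy : 0 ≤ y) {m : ℕ} (hm : x < m) :
    ∑ k ∈ Finset.range m, tent (x - k) * tent (y - k) =
      if ⌊x⌋₊ = ⌊y⌋₊ then tent (x - ⌊x⌋₊) * tent (y - ⌊x⌋₊) else 0 := by
  rw [Finset.sum_eq_single_of_mem ⌊x⌋₊ (by simpa using (Nat.floor_lt hx).2 hm)]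
  · split_ifs with h
    · rfl
    · rw [tent_sub_natCast_eq_zero hy h, mul_zero]
  · intro k _ hk
    rw [tent_sub_natCast_eq_zero hx hk, zero_mul]

theorem floor_two_mul {x : ℝ} (hx : 0 ≤ x) :
    (⌊2 * x⌋₊ = 2 * ⌊x⌋₊ ∧ x - ⌊x⌋₊ < 1 / 2) ∨
      (⌊2 * x⌋₊ = 2 * ⌊x⌋₊ + 1 ∧ 1 / 2 ≤ x - ⌊x⌋₊) := by
  have h1 := Nat.floor_le hx
  have h2 := Nat.lt_floor_add_one x
  rcases lt_or_ge (x - ⌊x⌋₊) (1 / 2) with h | h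
  · refine Or.inl ⟨(Nat.floor_eq_iff (by positivity)).2 ⟨?_, ?_⟩, h⟩ <;> push_cast <;> linarith
  · refine Or.inr ⟨(Nat.floor_eq_iff (by positivity)).2 ⟨?_, ?_⟩, h⟩ <;> push_cast <;> linarith

/-- A Brownian bridge is a tent carrying its midpoint value plus two independent bridges on the half
intervals, whose covariance is scaled by `1 / 2`. -/
theorem bridgeCov_eq_add {x y : ℝ} (hx : 0 ≤ x) (hy : 0 ≤ y) :
    bridgeCov x y = (if ⌊x⌋₊ = ⌊y⌋₊ then tent (x - ⌊x⌋₊) * tent (y - ⌊x⌋₊) else 0) +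
      1 / 2 * bridgeCov (2 * x) (2 * y) := by
  have h1 := Nat.floor_le hx
  have h2 := Nat.lt_floor_add_one x
  have h3 := Nat.floor_le hy
  have h4 := Nat.lt_floor_add_one y
  have tent_left : ∀ z : ℝ, 0 ≤ z → z ≤ 1 / 2 → tent z = z := fun z hz hz' => by
    rw [tent, min_eq_left (by linarith), max_eq_right hz]
  have tent_right : ∀ z : ℝ, 1 / 2 ≤ z → z ≤ 1 → tent z = 1 - z := fun z hz hz' => by
    rw [tent, min_eq_right (by linarith), max_eq_right (by linarith)]
  have hmin : min (2 * x) (2 * y) = 2 * min x y := (mul_min_of_nonneg _ _ (by norm_num)).symm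
  unfold bridgeCov
  rw [hmin]
  by_cases h : ⌊x⌋₊ = ⌊y⌋₊
  · rw [if_pos h, if_pos h]
    rcases floor_two_mul hx with ⟨hx1, hx2⟩ | ⟨hx1, hx2⟩ <;>
      rcases floor_two_mul hy with ⟨hy1, hy2⟩ | ⟨hy1, hy2⟩ <;>
      rw [hx1, hy1] <;> rw [← h] at h3 h4 hy2 ⊢
    · rw [if_pos rfl, tent_left _ (by linarith) hx2.le, tent_left _ (by linarith) hy2.le]
      push_cast
      ring
    · rw [if_neg (by lia), tent_left _ (by linarith) hx2.le, tent_right _ hy2 (by linarith),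
        min_eq_left (by linarith)]
      ring
    · rw [if_neg (by lia), tent_right _ hx2 (by linarith), tent_left _ (by linarith) hy2.le,
        min_eq_right (by linarith)]
      ring
    · rw [if_pos rfl, tent_right _ hx2 (by linarith), tent_right _ hy2 (by linarith)]
      push_cast
      ring
  · rw [if_neg h, if_neg h, if_neg]
    · simp
    · rcases floor_two_mul hx with ⟨hx1, _⟩ | ⟨hx1, _⟩ <;>
        rcases floor_two_mul hy with ⟨hy1, _⟩ | ⟨hy1, _⟩ <;> lia

/-- The ramps give the linear interpolation of Brownian motion at the integers; what is missing from
`min s t` is the covariance of the bridges. -/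
theorem sum_schauder_zero_mul {s t : ℝ} (hs : 0 ≤ s) (hst : s ≤ t) {m : ℕ} (hm : s < m) :
    ∑ k ∈ Finset.range m, schauder 0 k s * schauder 0 k t = s - bridgeCov s t := by
  have h1 := Nat.floor_le hs
  have h2 := Nat.lt_floor_add_one s
  have hfm : ⌊s⌋₊ + 1 ≤ m := (Nat.floor_lt hs).2 hm
  have hone : ∀ k u, k < ⌊s⌋₊ → s ≤ u → schauder 0 k u = 1 := by
    intro k u hk hu
    have : (k : ℝ) + 1 ≤ ⌊s⌋₊ := by exact_mod_cast hk
    rw [schauder, min_eq_left (by linarith), max_eq_right zero_le_one]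
  rw [← Finset.sum_subset (Finset.range_mono hfm), Finset.sum_range_succ,
    Finset.sum_congr rfl (g := fun _ => (1 : ℝ))]
  · have hss : schauder 0 ⌊s⌋₊ s = s - ⌊s⌋₊ := by
      rw [schauder, min_eq_right (by linarith), max_eq_right (by linarith)]
    rw [hss]
    have h3 := Nat.floor_le (hs.trans hst)
    have h4 := Nat.lt_floor_add_one t
    by_cases h : ⌊s⌋₊ = ⌊t⌋₊
    · rw [← h] at h3 h4
      rw [bridgeCov, if_pos h, schauder, min_eq_right (by linarith), max_eq_right (by linarith),
        min_eq_left hst]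
      simp
      ring
    · have hlt : ⌊s⌋₊ + 1 ≤ ⌊t⌋₊ := lt_of_le_of_ne (Nat.floor_mono hst) h
      have : (⌊s⌋₊ : ℝ) + 1 ≤ ⌊t⌋₊ := by exact_mod_cast hlt
      rw [bridgeCov, if_neg h, schauder, min_eq_left (by linarith), max_eq_right zero_le_one]
      simp
  · intro k hk
    rw [Finset.mem_range] at hk
    rw [hone k s hk le_rfl, hone k t hk hst, mul_one]
  · intro k _ hk
    rw [Finset.mem_range, not_lt] at hk
    have : (⌊s⌋₊ : ℝ) + 1 ≤ k := by exact_mod_cast hk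
    rw [schauder_eq_zero hs (by simp; linarith), zero_mul]

/-- Up to an error of size `2 ^ (-n)`, the Haar expansion of the covariance of Brownian motion. -/
theorem sum_sum_schauder_mul {s t : ℝ} (hs : 0 ≤ s) (ht : 0 ≤ t) (n : ℕ) {m : ℕ}
    (hsm : 2 ^ n * s < m) (htm : 2 ^ n * t < m) :
    ∑ i ∈ Finset.range (n + 1), ∑ k ∈ Finset.range m, schauder i k s * schauder i k t =
      min s t - (1 / 2) ^ n * bridgeCov (2 ^ n * s) (2 ^ n * t) := by
  induction n with
  | zero =>
    simp only [pow_zero, one_mul] at hsm htm ⊢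
    rw [zero_add, Finset.sum_range_one]
    rcases le_total s t with h | h
    · rw [sum_schauder_zero_mul hs h hsm, min_eq_left h]
    · simp_rw [mul_comm (schauder 0 _ s)]
      rw [sum_schauder_zero_mul ht h htm, min_eq_right h]
      have : bridgeCov t s = bridgeCov s t := by
        unfold bridgeCov
        by_cases h : ⌊s⌋₊ = ⌊t⌋₊
        · rw [if_pos h, if_pos h.symm, min_comm, h]; ring
        · rw [if_neg h, if_neg (Ne.symm h)]
      rw [this]
  | succ n ih =>
    have hle : ∀ u : ℝ, 0 ≤ u → (2 : ℝ) ^ n * u ≤ 2 ^ (n + 1) * u := fun u hu => by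
      gcongr
      · norm_num
      · exact n.le_succ
    have hs' := (hle s hs).trans_lt hsm
    have ht' := (hle t ht).trans_lt htm
    rw [Finset.sum_range_succ, ih hs' ht', bridgeCov_eq_add (by positivity) (by positivity),
      ← sum_tent_mul_tent (by positivity) (by positivity) hs']
    have hlast : ∑ k ∈ Finset.range m, schauder (n + 1) k s * schauder (n + 1) k t =
        (1 / 2) ^ n * ∑ k ∈ Finset.range m, tent (2 ^ n * s - k) * tent (2 ^ n * t - k) := by
      rw [Finset.mul_sum]
      refine Finset.sum_congr rfl fun k _ => ?_
      have : (√2 ^ n)⁻¹ * (√2 ^ n)⁻¹ = (1 / 2 : ℝ) ^ n := by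
        rw [← mul_inv, ← mul_pow, Real.mul_self_sqrt (by norm_num), one_div, inv_pow]
      rw [schauder, schauder, ← this]
      ring
    rw [hlast, ← mul_assoc 2 _ s, ← mul_assoc 2 _ t, ← pow_succ' 2 n, pow_succ (1 / 2 : ℝ) n]
    ring

end Schauder

/-! ### Convergence and law of the random Schauder series. -/

section LevyConstruction

/-- The law of a family of independent standard Gaussian variables, indexed by `ℕ × ℕ`. -/
noncomputable def gaussianNoise : Measure (ℕ × ℕ → ℝ) :=
  Measure.infinitePi fun _ => gaussianReal 0 1

instance : IsProbabilityMeasure gaussianNoise := by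
  unfold gaussianNoise; infer_instance

theorem charFun_map_sum_gaussianNoise (S : Finset (ℕ × ℕ)) (c : ℕ × ℕ → ℝ) :
    ∫ ω, Complex.exp ((∑ i ∈ S, c i * ω i : ℝ) * Complex.I) ∂gaussianNoise =
      Complex.exp ((-(∑ i ∈ S, c i ^ 2) / 2 : ℝ)) := by
  have hmeas : ∀ i : ℕ × ℕ, Measurable fun ω : ℕ × ℕ → ℝ => c i * ω i := fun i => by fun_prop
  have hind : iIndepFun (fun (i : ℕ × ℕ) (ω : ℕ × ℕ → ℝ) => c i * ω i) gaussianNoise :=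
    iIndepFun_infinitePi (X := fun i x => c i * x) fun i => by fun_prop
  have h := (hind.restrict S).charFun_map_fun_finsetSum_eq_prod
    (fun i _ => (hmeas i).aemeasurable)
  have h1 := congrFun h 1
  have hsum : Measurable fun ω : ℕ × ℕ → ℝ => ∑ i ∈ S, c i * ω i := by fun_prop
  rw [charFun_apply_real, integral_map hsum.aemeasurable (by fun_prop), Finset.prod_apply] at h1
  have hlaw : ∀ i : ℕ × ℕ, charFun (gaussianNoise.map fun ω : ℕ × ℕ → ℝ => c i * ω i) 1 =
      Complex.exp ((-(c i ^ 2) / 2 : ℝ)) := by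
    intro i
    have hm : gaussianNoise.map (fun ω : ℕ × ℕ → ℝ => ω i) = gaussianReal 0 1 :=
      Measure.infinitePi_map_eval _ i
    have : gaussianNoise.map (fun ω : ℕ × ℕ → ℝ => c i * ω i) =
        (gaussianReal 0 1).map (fun x => c i * x) := by
      rw [← hm, Measure.map_map (by fun_prop) (by fun_prop)]
      rfl
    rw [this, gaussianReal_map_const_mul, charFun_gaussianReal]
    congr 1
    simp [neg_div]
  simp only [hlaw, ← Complex.exp_sum] at h1
  rw [← Complex.ofReal_sum, ← Finset.sum_div, Finset.sum_neg_distrib] at h1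
  simpa using h1

/-- The sum of the terms of the given level in the Schauder expansion. -/
noncomputable def levelSum (ω : ℕ × ℕ → ℝ) (n : ℕ) (t : ℝ≥0) : ℝ :=
  ∑ k ∈ Finset.range (⌊2 ^ n * (t : ℝ)⌋₊ + 1), ω (n, k) * schauder n k t

theorem levelSum_eq_sum_range (ω : ℕ × ℕ → ℝ) {n m : ℕ} {t : ℝ≥0} (hm : 2 ^ n * (t : ℝ) < m) :
    levelSum ω n t = ∑ k ∈ Finset.range m, ω (n, k) * schauder n k t := by
  refine Finset.sum_subset (Finset.range_mono ((Nat.floor_lt (by positivity)).2 hm))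
    fun k _ hk => ?_
  rw [Finset.mem_range, not_lt] at hk
  have h1 := Nat.lt_floor_add_one (2 ^ n * (t : ℝ))
  have h2 : (⌊2 ^ n * (t : ℝ)⌋₊ : ℝ) + 1 ≤ k := by exact_mod_cast hk
  rw [schauder_eq_zero t.coe_nonneg (h1.le.trans h2), mul_zero]

theorem continuous_levelSum (ω : ℕ × ℕ → ℝ) (n : ℕ) : Continuous (levelSum ω n) := by
  refine continuous_iff_continuousAt.2 fun t₀ => ?_
  -- The range of summation depends on `t`; near `t₀` one fixed range serves for all times.
  obtain ⟨m, hm⟩ := exists_nat_gt (2 ^ n * ((t₀ : ℝ) + 1))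
  have hev : levelSum ω n =ᶠ[𝓝 t₀]
      fun t => ∑ k ∈ Finset.range m, ω (n, k) * schauder n k t := by
    filter_upwards [Iio_mem_nhds (lt_add_one t₀)] with t ht
    refine levelSum_eq_sum_range ω (lt_of_le_of_lt ?_ hm)
    gcongr
    exact_mod_cast (Set.mem_Iio.1 ht).le
  refine ContinuousAt.congr ?_ hev.symm
  refine (continuous_finsetSum _ fun k _ => ?_).continuousAt
  exact continuous_const.mul ((continuous_schauder n k).comp NNReal.continuous_coe)

theorem measurable_levelSum (n : ℕ) (t : ℝ≥0) : Measurable fun ω => levelSum ω n t := by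
  unfold levelSum
  fun_prop

theorem levelSum_zero (ω : ℕ × ℕ → ℝ) (n : ℕ) : levelSum ω n 0 = 0 :=
  Finset.sum_eq_zero fun k _ => by rw [schauder_eq_zero (by simp) (by simp), mul_zero]

/-- Tents of one level have disjoint supports, so at most one term is nonzero. -/
theorem abs_levelSum_succ_le (ω : ℕ × ℕ → ℝ) (n : ℕ) (t : ℝ≥0) :
    |levelSum ω (n + 1) t| ≤ (√2 ^ n)⁻¹ * |ω (n + 1, ⌊2 ^ n * (t : ℝ)⌋₊)| := by
  have hmem : ⌊2 ^ n * (t : ℝ)⌋₊ ∈ Finset.range (⌊2 ^ (n + 1) * (t : ℝ)⌋₊ + 1) := by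
    rw [Finset.mem_range, Nat.lt_succ_iff]
    refine Nat.floor_mono ?_
    gcongr
    · norm_num
    · exact n.le_succ
  rw [levelSum, Finset.sum_eq_single_of_mem _ hmem]
  · rw [schauder, abs_mul, abs_mul, abs_of_nonneg (a := (√2 ^ n)⁻¹) (by positivity)]
    calc |ω (n + 1, ⌊2 ^ n * (t : ℝ)⌋₊)| * ((√2 ^ n)⁻¹ * |tent (2 ^ n * t - ⌊2 ^ n * (t : ℝ)⌋₊)|)
        ≤ |ω (n + 1, ⌊2 ^ n * (t : ℝ)⌋₊)| * ((√2 ^ n)⁻¹ * 1) := by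
          gcongr
          exact abs_tent_le_one _
      _ = _ := by ring
  · intro k _ hk
    rw [schauder, tent_sub_natCast_eq_zero (by positivity) hk, mul_zero, mul_zero]

/-- With summable weights `w`, the series `∑ ω i ^ 8 * w i` has finite expectation, so it is almost
surely finite and bounds each of its terms; `C` is its sum. -/
theorem ae_exists_pow_le :
    ∀ᵐ ω ∂gaussianNoise, ∃ C : ℝ, 0 ≤ C ∧ ∀ n k : ℕ,
      ω (n, k) ^ 8 ≤ C * (((k : ℝ) + 1) ^ 2 * 2 ^ n) := by
  let w : ℕ × ℕ → ℝ := fun i => (1 / 2) ^ i.1 * (1 / ((i.2 : ℝ) + 1) ^ 2)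
  have hw0 : ∀ i, 0 ≤ w i := fun i => by positivity
  have hw : Summable w := by
    refine summable_geometric_two.mul_of_nonneg (g := fun k : ℕ => 1 / ((k : ℝ) + 1) ^ 2)
      ?_ (fun _ => by positivity) (fun _ => by positivity)
    have := (summable_nat_add_iff 1).2 (Real.summable_one_div_nat_pow.2 one_lt_two)
    simpa using this
  set M := ∫⁻ x, ENNReal.ofReal (x ^ 8) ∂gaussianReal 0 1 with hM
  have hMfin : M ≠ ⊤ := by
    have hint : Integrable (fun x : ℝ => x ^ 8) (gaussianReal 0 1) := by
      have := (memLp_id_gaussianReal (μ := 0) (v := 1) 8).integrable_norm_pow (by norm_num)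
      simpa [Even.pow_abs (by decide : Even 8)] using this
    exact (hint.lintegral_lt_top).ne
  have hlint : ∀ i : ℕ × ℕ, ∫⁻ ω, ENNReal.ofReal (ω i ^ 8 * w i) ∂gaussianNoise =
      M * ENNReal.ofReal (w i) := by
    intro i
    have h8 : ∀ x : ℝ, 0 ≤ x ^ 8 := fun x => by positivity
    simp_rw [ENNReal.ofReal_mul (h8 _)]
    rw [lintegral_mul_const _ (by fun_prop), hM]
    congr 1
    exact (measurePreserving_eval_infinitePi (fun _ => gaussianReal 0 1) i).lintegral_comp
      (f := fun x => ENNReal.ofReal (x ^ 8)) (by fun_prop)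
  have hfin : ∫⁻ ω, ∑' i, ENNReal.ofReal (ω i ^ 8 * w i) ∂gaussianNoise ≠ ⊤ := by
    rw [lintegral_tsum fun i => Measurable.aemeasurable (by fun_prop)]
    simp_rw [hlint]
    rw [ENNReal.tsum_mul_left]
    exact ENNReal.mul_ne_top hMfin hw.tsum_ofReal_ne_top
  filter_upwards [ae_lt_top (Measurable.tsum fun i => by fun_prop) hfin] with ω hω
  refine ⟨(∑' i, ENNReal.ofReal (ω i ^ 8 * w i)).toReal, ENNReal.toReal_nonneg, fun n k => ?_⟩
  have h1 := ENNReal.le_tsum (f := fun i => ENNReal.ofReal (ω i ^ 8 * w i)) (n, k)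
  have h2 := (ENNReal.ofReal_le_iff_le_toReal hω.ne).1 h1
  have h3 : w (n, k) * (((k : ℝ) + 1) ^ 2 * 2 ^ n) = 1 := by
    simp only [w]
    rw [one_div_pow]
    field_simp
  calc ω (n, k) ^ 8 = ω (n, k) ^ 8 * w (n, k) * (((k : ℝ) + 1) ^ 2 * 2 ^ n) := by
        rw [mul_assoc, h3, mul_one]
    _ ≤ _ := by gcongr

/-- Almost surely, the Schauder expansion converges normally on the bounded intervals. -/
theorem ae_exists_summable_bound :
    ∀ᵐ ω ∂gaussianNoise, ∀ K : ℕ, ∃ u : ℕ → ℝ, Summable u ∧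
      ∀ n, ∀ t : ℝ≥0, t ≤ K → |levelSum ω (n + 1) t| ≤ u n := by
  filter_upwards [ae_exists_pow_le] with ω hω K
  obtain ⟨C, hC, hω⟩ := hω
  -- The eighth power of a level is at most a constant times `2 ^ (-4n) * 2 ^ (2n) * 2 ^ n = 2 ^
  -- (-n)`: amplitude, then `(k + 1) ^ 2`, then the level weight. Eight is the least even exponent
  -- for which this decays.
  set q : ℝ := (1 / 2 : ℝ) ^ (1 / 8 : ℝ) with hq
  have hq8 : q ^ 8 = 1 / 2 := by
    rw [hq, ← Real.rpow_mul_natCast (by norm_num)]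
    norm_num
  have hq0 : 0 ≤ q := by positivity
  have hq1 : q < 1 := Real.rpow_lt_one (by norm_num) (by norm_num) (by norm_num)
  set D : ℝ := 2 * C * ((K : ℝ) + 1) ^ 2 with hD
  have hD0 : 0 ≤ D := by positivity
  have hD8 : (D ^ (1 / 8 : ℝ)) ^ 8 = D := by
    rw [← Real.rpow_mul_natCast hD0]
    norm_num
  refine ⟨fun n => D ^ (1 / 8 : ℝ) * q ^ n,
    (summable_geometric_of_lt_one hq0 hq1).mul_left _, fun n t ht => ?_⟩
  refine (abs_levelSum_succ_le ω n t).trans ?_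
  refine (pow_le_pow_iff_left₀ (by positivity) (by positivity) (by norm_num : 8 ≠ 0)).1 ?_
  have hk : (⌊2 ^ n * (t : ℝ)⌋₊ : ℝ) + 1 ≤ 2 ^ n * (K + 1) := by
    have h1 := Nat.floor_le (a := 2 ^ n * (t : ℝ)) (by positivity)
    have h2 : (t : ℝ) ≤ K := by exact_mod_cast ht
    have h3 : (1 : ℝ) ≤ 2 ^ n := one_le_pow₀ (by norm_num)
    have h4 : (2 : ℝ) ^ n * t ≤ 2 ^ n * K := by gcongr
    linarith
  have hsqrt : ((√2 ^ n)⁻¹) ^ 8 = ((1 / 2 : ℝ) ^ n) ^ 4 := by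
    have : √2 ^ 8 = 2 ^ 4 := by
      rw [show √2 ^ 8 = (√2 ^ 2) ^ 4 by ring, Real.sq_sqrt (by norm_num)]
    rw [inv_pow, ← pow_mul, mul_comm n 8, pow_mul, this, ← pow_mul, ← pow_mul, one_div, inv_pow,
      mul_comm]
  rw [mul_pow, mul_pow, hsqrt, hD8, Even.pow_abs (by decide), ← pow_mul q, mul_comm n 8,
    pow_mul q, hq8]
  calc ((1 / 2 : ℝ) ^ n) ^ 4 * ω (n + 1, ⌊2 ^ n * (t : ℝ)⌋₊) ^ 8
      ≤ ((1 / 2 : ℝ) ^ n) ^ 4 * (C * ((2 ^ n * (K + 1)) ^ 2 * 2 ^ (n + 1))) := by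
        gcongr
        refine (hω _ _).trans ?_
        gcongr
    _ = D * (1 / 2) ^ n := by
        have h : (1 / 2 : ℝ) ^ n * 2 ^ n = 1 := by rw [← mul_pow]; norm_num
        calc _ = D * (1 / 2) ^ n * ((1 / 2 : ℝ) ^ n * 2 ^ n) ^ 3 := by rw [hD]; ring
          _ = _ := by rw [h]; ring

/-- Lévy's construction of Brownian motion. -/
noncomputable def levyProcess (t : ℝ≥0) (ω : ℕ × ℕ → ℝ) : ℝ :=
  levelSum ω 0 t + ∑' n, levelSum ω (n + 1) t

/-- It holds for every `ω`, not just almost surely, which makes the Hermite identities hold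
pointwise at `t = 0` too. -/
theorem levyProcess_zero (ω : ℕ × ℕ → ℝ) : levyProcess 0 ω = 0 := by
  simp [levyProcess, levelSum_zero]

theorem ae_continuous_levyProcess : ∀ᵐ ω ∂gaussianNoise, Continuous fun t => levyProcess t ω := by
  filter_upwards [ae_exists_summable_bound] with ω hω
  refine (continuous_levelSum ω 0).add (continuous_iff_continuousAt.2 fun t₀ => ?_)
  obtain ⟨K, hK⟩ := exists_nat_gt t₀
  obtain ⟨u, hu, hb⟩ := hω K
  have := continuousOn_tsum (f := fun n t => levelSum ω (n + 1) t) (s := Set.Iic (K : ℝ≥0))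
    (fun n => (continuous_levelSum ω (n + 1)).continuousOn) hu fun n t ht => hb n t ht
  exact this.continuousAt (Iic_mem_nhds hK)

theorem ae_tendsto_levyProcess : ∀ᵐ ω ∂gaussianNoise, ∀ t,
    Tendsto (fun n => ∑ i ∈ Finset.range (n + 1), levelSum ω i t) atTop
      (𝓝 (levyProcess t ω)) := by
  filter_upwards [ae_exists_summable_bound] with ω hω t
  obtain ⟨K, hK⟩ := exists_nat_gt t
  obtain ⟨u, hu, hb⟩ := hω K
  have hs : Summable fun n => levelSum ω (n + 1) t :=
    Summable.of_norm_bounded hu fun n => hb n t hK.le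
  have := (hs.hasSum.tendsto_sum_nat).const_add (levelSum ω 0 t)
  refine this.congr fun n => ?_
  rw [Finset.sum_range_succ', add_comm]

theorem aemeasurable_levyProcess (t : ℝ≥0) : AEMeasurable (levyProcess t) gaussianNoise := by
  refine aemeasurable_of_tendsto_metrizable_ae atTop
    (f := fun n ω => ∑ i ∈ Finset.range (n + 1), levelSum ω i t) (fun n => ?_) ?_
  · exact (Finset.measurable_fun_sum _ fun i _ => measurable_levelSum i t).aemeasurable
  · filter_upwards [ae_tendsto_levyProcess] with ω hω using hω t

theorem charFun_partial_levyProcess {ι : Type*} [Fintype ι] (t : ι → ℝ≥0) (c : ι → ℝ) (n : ℕ) :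
    ∫ ω, Complex.exp ((∑ j, c j * ∑ i ∈ Finset.range (n + 1), levelSum ω i (t j) : ℝ) *
        Complex.I) ∂gaussianNoise =
      Complex.exp ((-(∑ j, ∑ l, c j * c l * (min (t j : ℝ) (t l) -
        (1 / 2) ^ n * bridgeCov (2 ^ n * t j) (2 ^ n * t l))) / 2 : ℝ)) := by
  obtain ⟨m, hm⟩ : ∃ m : ℕ, ∀ j, 2 ^ n * (t j : ℝ) < m := by
    obtain ⟨m, hm⟩ := exists_nat_gt (∑ j, 2 ^ n * (t j : ℝ))
    refine ⟨m, fun j => lt_of_le_of_lt ?_ hm⟩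
    exact Finset.single_le_sum (f := fun j => 2 ^ n * (t j : ℝ)) (fun _ _ => by positivity)
      (Finset.mem_univ j)
  have hlevel : ∀ ω j, ∀ i ∈ Finset.range (n + 1), levelSum ω i (t j) =
      ∑ k ∈ Finset.range m, ω (i, k) * schauder i k (t j) := by
    intro ω j i hi
    refine levelSum_eq_sum_range ω (lt_of_le_of_lt ?_ (hm j))
    gcongr
    · norm_num
    · exact Nat.lt_succ_iff.1 (Finset.mem_range.1 hi)
  have hsum : ∀ ω : ℕ × ℕ → ℝ, ∑ j, c j * ∑ i ∈ Finset.range (n + 1), levelSum ω i (t j) =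
      ∑ p ∈ Finset.range (n + 1) ×ˢ Finset.range m,
        (∑ j, c j * schauder p.1 p.2 (t j)) * ω p := by
    intro ω
    simp_rw [Finset.sum_mul]
    rw [Finset.sum_comm]
    refine Finset.sum_congr rfl fun j _ => ?_
    rw [Finset.sum_congr rfl (hlevel ω j), Finset.sum_product, Finset.mul_sum]
    refine Finset.sum_congr rfl fun i _ => ?_
    rw [Finset.mul_sum]
    exact Finset.sum_congr rfl fun k _ => by ring
  simp_rw [hsum]
  rw [charFun_map_sum_gaussianNoise _ fun p => ∑ j, c j * schauder p.1 p.2 (t j)]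
  congr 5
  simp_rw [← sum_sum_schauder_mul (t _).coe_nonneg (t _).coe_nonneg n (hm _) (hm _), pow_two,
    Finset.sum_mul_sum, Finset.mul_sum]
  rw [Finset.sum_comm]
  refine Finset.sum_congr rfl fun j _ => ?_
  rw [Finset.sum_comm]
  refine Finset.sum_congr rfl fun l _ => ?_
  rw [Finset.sum_product]
  exact Finset.sum_congr rfl fun i _ => Finset.sum_congr rfl fun k _ => by ring

/-- Dominated convergence applies on the left since the exponentials have modulus one; on the right
the error `2 ^ (-n) * bridgeCov` vanishes because `bridgeCov` is bounded. -/
theorem charFun_levyProcess {ι : Type*} [Fintype ι] (t : ι → ℝ≥0) (c : ι → ℝ) :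
    ∫ ω, Complex.exp ((∑ j, c j * levyProcess (t j) ω : ℝ) * Complex.I) ∂gaussianNoise =
      Complex.exp ((-(∑ j, ∑ l, c j * c l * min (t j : ℝ) (t l)) / 2 : ℝ)) := by
  have h1 : Tendsto (fun n : ℕ => ∫ ω, Complex.exp
      ((∑ j, c j * ∑ i ∈ Finset.range (n + 1), levelSum ω i (t j) : ℝ) * Complex.I)
        ∂gaussianNoise) atTop
      (𝓝 (∫ ω, Complex.exp ((∑ j, c j * levyProcess (t j) ω : ℝ) * Complex.I)
        ∂gaussianNoise)) := by
    refine tendsto_integral_of_dominated_convergence (fun _ => 1) (fun n => ?_)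
      (integrable_const _) (fun n => Eventually.of_forall fun ω => ?_) ?_
    · refine Measurable.aestronglyMeasurable ?_
      have : ∀ i t, Measurable fun ω => levelSum ω i t := measurable_levelSum
      fun_prop
    · rw [Complex.norm_exp_ofReal_mul_I]
    · filter_upwards [ae_tendsto_levyProcess] with ω hω
      have hc : Continuous fun x : ℝ => Complex.exp (x * Complex.I) := by fun_prop
      exact (hc.tendsto _).comp (tendsto_finsetSum _ fun j _ => (hω (t j)).const_mul (c j))
  simp_rw [charFun_partial_levyProcess] at h1
  refine tendsto_nhds_unique h1 ?_
  have hb : ∀ j l, Tendsto (fun n : ℕ => (1 / 2 : ℝ) ^ n *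
      bridgeCov (2 ^ n * t j) (2 ^ n * t l)) atTop (𝓝 0) := by
    intro j l
    refine squeeze_zero_norm (fun n => ?_) (tendsto_pow_atTop_nhds_zero_of_lt_one
      (r := (1 / 2 : ℝ)) (by norm_num) (by norm_num))
    rw [norm_mul, Real.norm_eq_abs, Real.norm_eq_abs,
      abs_of_nonneg (a := (1 / 2 : ℝ) ^ n) (by positivity)]
    exact mul_le_of_le_one_right (by positivity)
      (abs_bridgeCov_le_one (by positivity) (by positivity))
  have hc : Continuous fun x : ℝ => Complex.exp ((-x / 2 : ℝ)) := by fun_prop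
  refine (hc.tendsto _).comp (tendsto_finsetSum _ fun j _ => tendsto_finsetSum _ fun l _ => ?_)
  simpa using ((hb j l).const_sub (min (t j : ℝ) (t l))).const_mul (c j * c l)

theorem isBrownianReal_levyProcess : IsBrownianReal levyProcess gaussianNoise where
  cont := ae_continuous_levyProcess
  hasLaw I := by
    have hmeas : AEMeasurable (fun ω => I.restrict (levyProcess · ω)) gaussianNoise :=
      aemeasurable_pi_lambda _ fun t => aemeasurable_levyProcess t
    refine ⟨hmeas, ?_⟩
    -- The laws are compared on Euclidean space, where characteristic functions determine measures.
    apply (MeasurableEquiv.toLp 2 (I → ℝ)).map_measurableEquiv_injective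
    rw [MeasurableEquiv.coe_toLp,
      (BrownianReal.measurePreserving_toLp_projectiveFamily I).map_eq]
    refine Measure.ext_of_charFun (funext fun x => ?_)
    rw [charFun_multivariateGaussian (BrownianReal.posSemidef_covMatrix I), charFun_apply,
      integral_map (by fun_prop) (by fun_prop), integral_map hmeas (by fun_prop)]
    have h := charFun_levyProcess (fun j : I => (j : ℝ≥0)) (fun j : I => x j)
    simp only [inner_zero_right, Complex.ofReal_zero, zero_mul, zero_sub]
    convert h using 4
    · simp [PiLp.inner_apply, mul_comm]
    · simp [dotProduct, Matrix.mulVec, Finset.mul_sum, BrownianReal.covMatrix_apply]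
      rw [neg_div]
      refine congrArg (fun z : ℂ => -(z / 2)) ?_
      exact Finset.sum_congr rfl fun j _ => Finset.sum_congr rfl fun l _ => by ring

end LevyConstruction

/-! ### Hermite polynomials -/

section Hermite

open Polynomial in
-- It turns the recursion `H_(n+1) = X H_n - H_n'` into the three-term recurrence.
theorem derivative_hermite_succ (n : ℕ) :
    derivative (hermite (n + 1)) = (n + 1 : ℤ[X]) * hermite n := by
  induction n with
  | zero => simp
  | succ n ih =>
    rw [hermite_succ (n + 1), derivative_sub, derivative_mul, ih, derivative_X, one_mul,
      derivative_mul, hermite_succ n]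
    have : derivative (n + 1 : ℤ[X]) = 0 := by
      rw [derivative_add, derivative_natCast, derivative_one, add_zero]
    rw [this]
    push_cast
    ring

theorem scaledHermite_zero_left (t : ℝ≥0) (x : ℝ) : scaledHermite 0 t x = 1 := by
  simp [scaledHermite]

theorem scaledHermite_one {t : ℝ≥0} {x : ℝ} (hx : t = 0 → x = 0) : scaledHermite 1 t x = x := by
  by_cases ht : t = 0
  · rw [ht, scaledHermite_zero le_rfl, hx ht]
  · have ht' : (0 : ℝ) < t := by positivity
    rw [scaledHermite, Polynomial.hermite_one, Polynomial.aeval_X, ← mul_assoc,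
      ← Real.rpow_add ht']
    norm_num

theorem scaledHermite_add_two (r : ℕ) {t : ℝ≥0} {x : ℝ} (hx : t = 0 → x = 0) :
    scaledHermite (r + 2) t x =
      x * scaledHermite (r + 1) t x - (r + 1) * t * scaledHermite r t x := by
  by_cases ht : t = 0
  · rw [hx ht, ht, scaledHermite_zero (by lia)]
    simp
  · have ht' : (0 : ℝ) < t := by positivity
    have h1 : (t : ℝ) ^ (((r + 2 : ℕ) : ℝ) / 2) = t * (t : ℝ) ^ ((r : ℝ) / 2) := by
      rw [← Real.rpow_one_add' ht'.le (by positivity)]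
      congr 1
      push_cast
      ring
    have h2 : (t : ℝ) ^ (((r + 2 : ℕ) : ℝ) / 2) * (t : ℝ) ^ (-(1 / 2) : ℝ) =
        (t : ℝ) ^ (((r + 1 : ℕ) : ℝ) / 2) := by
      rw [← Real.rpow_add ht']
      congr 1
      push_cast
      ring
    simp only [scaledHermite]
    rw [Polynomial.hermite_succ (r + 1), derivative_hermite_succ, ← h2]
    simp only [map_sub, map_mul, map_add, map_natCast, map_one, Polynomial.aeval_X]
    rw [h1]
    ring

end Hermite

/-! ### Joint limits -/

section JointLimit

variable {Ω : Type*} [MeasurableSpace Ω] {P : Measure Ω} {B : ℝ≥0 → Ω → ℝ}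

/-- The sequence `a` of elements of the group algebra converges to the random variable `Z`, jointly
with the convergence of the elements `L_1(n, t)` to the random variables `B t`. -/
def JointLimit (B : ℝ≥0 → Ω → ℝ) (P : Measure Ω) (a : ℕ → MonoidAlgebra ℂ FinsetGroup)
    (Z : Ω → ℂ) : Prop :=
  HasAllMoments Z P ∧ ∀ l : List ℝ≥0,
    Tendsto (fun n => canonicalTrace FinsetGroup (a n * (l.map fun s => setSum 1 n s).prod))
      atTop (𝓝 (∫ ω, Z ω * (l.map fun s => (B s ω : ℂ)).prod ∂P))

theorem ProbabilityTheory.IsPreBrownianReal.jointLimit_one (hB : IsPreBrownianReal B P) :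
    JointLimit B P (fun _ => 1) (fun _ => 1) := by
  have hP := hB.isGaussianProcess.isProbabilityMeasure
  refine ⟨HasAllMoments.const 1, fun l => ?_⟩
  have h := tendsto_traceMul_wickSum l []
  have h1 : ∀ n, wickSum n [] = 1 := fun n => rfl
  simp only [traceMul_apply, h1, mul_one, ← hB.integral_prod_eq_contraction l] at h
  have h2 : ∀ ω, (1 : ℂ) * (l.map fun s => (B s ω : ℂ)).prod =
      (((l.map fun s => B s ω).prod : ℝ) : ℂ) := by
    intro ω
    rw [one_mul, ← Complex.ofRealHom_eq_coe, map_list_prod, List.map_map]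
    rfl
  simp only [h2, one_mul, setSum_one, integral_complex_ofReal]
  exact h

namespace JointLimit

variable {a b : ℕ → MonoidAlgebra ℂ FinsetGroup} {Z W : Ω → ℂ}

theorem congr' (ha : JointLimit B P a Z) (h : a =ᶠ[atTop] b) : JointLimit B P b Z :=
  ⟨ha.1, fun l => (ha.2 l).congr' (h.mono fun n hn => by rw [hn])⟩

theorem integrable_mul (hB : IsPreBrownianReal B P) (ha : JointLimit B P a Z) (l : List ℝ≥0) :
    Integrable (fun ω => Z ω * (l.map fun s => (B s ω : ℂ)).prod) P := by
  have hP := hB.isGaussianProcess.isProbabilityMeasure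
  exact (ha.1.mul (HasAllMoments.list_prod (fun s => (hB.hasAllMoments s).ofReal) l)).integrable

theorem add (hB : IsPreBrownianReal B P) (ha : JointLimit B P a Z) (hb : JointLimit B P b W) :
    JointLimit B P (fun n => a n + b n) (fun ω => Z ω + W ω) := by
  refine ⟨ha.1.add hb.1, fun l => ?_⟩
  simp only [add_mul, map_add]
  rw [integral_add (ha.integrable_mul hB l) (hb.integrable_mul hB l)]
  exact (ha.2 l).add (hb.2 l)

theorem algebraMap_mul {c : ℕ → ℂ} {d : ℂ} (hc : Tendsto c atTop (𝓝 d))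
    (ha : JointLimit B P a Z) :
    JointLimit B P (fun n => algebraMap ℂ _ (c n) * a n) (fun ω => d * Z ω) := by
  refine ⟨ha.1.const_mul d, fun l => ?_⟩
  simp only [mul_assoc, canonicalTrace_algebraMap_mul]
  rw [integral_const_mul]
  exact hc.mul (ha.2 l)

/-- The extra factor is absorbed into the list of test times. -/
theorem setSum_one_mul (hB : IsPreBrownianReal B P) (ha : JointLimit B P a Z) (t : ℝ≥0) :
    JointLimit B P (fun n => setSum 1 n t * a n) (fun ω => B t ω * Z ω) := by
  refine ⟨(hB.hasAllMoments t).ofReal.mul ha.1, fun l => ?_⟩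
  have h := ha.2 (t :: l)
  simp only [List.map_cons, List.prod_cons] at h
  convert h using 3
  · ring_nf
  · funext ω
    ring

theorem setSum_mul (hB : IsPreBrownianReal B P) (hB0 : ∀ ω, B 0 ω = 0)
    (ha : JointLimit B P a Z) (r : ℕ) (t : ℝ≥0) :
    JointLimit B P (fun n => setSum r n t * a n)
      (fun ω => (scaledHermite r t (B t ω) : ℂ) * Z ω) := by
  have h0 : ∀ ω, t = 0 → B t ω = 0 := fun ω ht => by rw [ht, hB0]
  induction r using Nat.twoStepInduction with
  | zero =>
    have h1 : ∀ n, setSum 0 n t = 1 := fun n => setSum_eq_wickSum n t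
    simpa only [h1, scaledHermite_zero_left, one_mul, Complex.ofReal_one] using ha
  | one => simpa only [scaledHermite_one (h0 _)] using ha.setSum_one_mul hB t
  | more r ih1 ih2 =>
    -- The coefficient of the discrete recurrence tends to the Hermite one, `-(r + 1) t`; the `0` is
    -- the limit of `n⁻¹`.
    have hc : Tendsto (fun n : ℕ => -((r + 1 : ℂ) *
        ((n : ℂ)⁻¹ * (timeRange n t).card - (n : ℂ)⁻¹ * r))) atTop
        (𝓝 (-((r + 1 : ℂ) * ((t : ℝ) - 0 * r)))) :=
      ((((tendsto_card_timeRange_div t).sub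
        (tendsto_inv_atTop_nhds_zero_nat.mul_const (r : ℂ)))).const_mul _).neg
    have h := (ih2.setSum_one_mul hB t).add hB (ih1.algebraMap_mul hc)
    have hZ : (fun ω => (scaledHermite (r + 2) t (B t ω) : ℂ) * Z ω) = fun ω =>
        B t ω * ((scaledHermite (r + 1) t (B t ω) : ℂ) * Z ω) +
          -((r + 1 : ℂ) * ((t : ℝ) - 0 * r)) * ((scaledHermite r t (B t ω) : ℂ) * Z ω) := by
      funext ω
      rw [scaledHermite_add_two r (h0 ω)]
      push_cast
      ring
    rw [hZ]
    refine h.congr' ?_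
    filter_upwards [eventually_ne_atTop 0] with n hn
    rw [setSum_add_two hn, map_neg]
    ring

theorem freeAlgebra_mul (hB : IsPreBrownianReal B P) (hB0 : ∀ ω, B 0 ω = 0)
    (p : FreeAlgebra ℂ (ℕ+ × ℝ≥0)) (ha : JointLimit B P a Z) :
    JointLimit B P
      (fun n => FreeAlgebra.lift ℂ (fun i : ℕ+ × ℝ≥0 => setSum i.1 n i.2) p * a n)
      (fun ω => polyRandomVariable
        (fun (i : ℕ+ × ℝ≥0) ω => scaledHermite i.1 i.2 (B i.2 ω)) p ω * Z ω) := by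
  unfold polyRandomVariable
  -- With `a` and `Z` arbitrary, a product `p * q` is handled by applying `q`, then `p`.
  induction p using FreeAlgebra.induction generalizing a Z with
  | grade0 c =>
    simp only [AlgHom.commutes]
    exact ha.algebraMap_mul tendsto_const_nhds
  | grade1 i =>
    simp only [FreeAlgebra.lift_ι_apply]
    exact ha.setSum_mul hB hB0 i.1 i.2
  | add p q hp hq =>
    simp only [map_add, add_mul]
    exact (hp ha).add hB (hq ha)
  | mul p q hp hq =>
    simp only [map_mul, mul_assoc]
    exact hp (hq ha)

end JointLimit

end JointLimit

theorem mainTheorem4 :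
    ∃ (Ω : Type) (_ : MeasurableSpace Ω) (P : Measure Ω) (_ : IsProbabilityMeasure P)
      (L : ℕ+ × ℝ≥0 → Ω → ℝ),
      IsBrownianReal (fun t => L (1, t)) P ∧
      (∀ (r : ℕ+) (t : ℝ≥0) (ω : Ω), L (r, t) ω = scaledHermite r t (L (1, t) ω)) ∧
      (∀ p : FreeAlgebra ℂ (ℕ+ × ℝ≥0), Integrable (polyRandomVariable L p) P) ∧
      (∀ p : FreeAlgebra ℂ (ℕ+ × ℝ≥0),
        Tendsto
          (fun n : ℕ =>
            ncDistribution (canonicalTrace FinsetGroup)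
              (fun i : ℕ+ × ℝ≥0 => setSum i.1 n i.2) p)
          atTop (𝓝 (classicalDistribution P L p))) := by
  have hB := isBrownianReal_levyProcess
  have hone : ∀ t ω, scaledHermite ((1 : ℕ+) : ℕ) t (levyProcess t ω) = levyProcess t ω :=
    fun t ω => scaledHermite_one fun ht => by rw [ht, levyProcess_zero]
  -- Start from the constant `1`; the empty test list then gives the convergence of the trace of
  -- `p`.
  have key : ∀ p : FreeAlgebra ℂ (ℕ+ × ℝ≥0), JointLimit levyProcess gaussianNoise _ _ := fun p =>
    hB.toIsPreBrownianReal.jointLimit_one.freeAlgebra_mul hB.toIsPreBrownianReal levyProcess_zero p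
  refine ⟨ℕ × ℕ → ℝ, inferInstance, gaussianNoise, inferInstance,
    fun i ω => scaledHermite i.1 i.2 (levyProcess i.2 ω), ?_, ?_, fun p => ?_, fun p => ?_⟩
  · simpa only [hone] using hB
  · intro r t ω
    simp only [hone]
  · simpa using (key p).1.integrable
  · have h := (key p).2 []
    simp only [List.map_nil, List.prod_nil, mul_one] at h
    exact h
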